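/- For $b\in\mathbb R$ let $F_b(x,y)=(|x|-y-1,\;x-|y|+b)$ on $\mathbb R^2$ and, for $4<b<8$, let $\Gamma_b\subset\mathbb R^2$ be the union of the five segments $$\overline{P_3P_{11}},\quad \overline{P_3P_5},\quad \overline{P_8P_6},\quad \overline{P_{11}P_9},\quad \overline{P_8P_{10}},$$ where $P_3=(-b-2,-1)$, $P_5=(b,-1)$, $P_6=(b+2,-3)$, $P_8=(0,b-1)$, $P_9=(b+4,2b-1)$, $P_{10}=(b,2b-1)$, $P_{11}=(b-2,2b-1)$. Then $\Gamma_b$ is compact and $F_b(\Gamma_b)=\Gamma_b$. Let $h_F(b)$ be the topological entropy of $F_b|_{\Gamma_b}$. Put $$p_n=\frac{4(4\cdot4^{n+1}-1)}{2\cdot4^{n+1}+1}\ (n\ge-1),\quad q_n=\frac{8\cdot4^{n+1}+1}{4^{n+1}+2},\quad r_n=\frac{16\cdot4^{n+1}-1}{2\cdot4^{n+1}+4},\quad s_n=\frac{2(4\cdot4^{n+2}-1)}{4^{n+2}+11}\quad(n\ge0).$$ For every $n\ge0$ one has $p_{n-1}<s_n<r_n<q_n<p_n$, and with $$S_n=(p_{n-1},s_n),\quad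 T_n=[s_n,r_n],\quad U_n=(r_n,q_n),\quad V_n=[q_n,p_n]$$ one has $(4,8)=\bigcup_{n\ge0}(S_n\cup T_n\cup U_n\cup V_n)$. Moreover $h_F(b)>0$ for all $b\in(4,8)$. Each of the following polynomials has a unique positive root, which is denoted as indicated: $$\begin{aligned} \alpha_n&:\ \lambda^{7+3n}-\lambda^{4+3n}-1, &\beta_n&:\ \lambda^{7+3n}-\lambda^{4+3n}-\lambda^3-2, &\delta_n&:\ \lambda^{7+3n}-\lambda^{4+3n}-2,\\ \gamma_n&:\ \lambda^{10+3n}-\lambda^{7+3n}-2\lambda^3-1, &\varphi_n&:\ \lambda^{10+3n}-\lambda^{7+3n}-\lambda^3-1, \end{aligned}$$ and, for every $n\ge0$: (a) if $b\in S_n$, then $\ln\alpha_n\le h_F(b)\le\ln\beta_n$; (b) if $b\in T_n$, then $h_F(b)=\ln\delta_n$; (c) if $b\in U_n$, then $\ln\alpha_n\le h_F(b)\le\ln\gamma_n$; (d) if $b\in V_n$, then $h_F(b)=\ln\varphi_n$. Furthermore $1<\alpha_n<\varphi_n<\delta_n<\gamma_n<\beta_n$ for every $n\ge0$; each of the five sequences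 is strictly decreasing and tends to $1$ as $n\to\infty$; hence the entropy $h_F(b)$ for $b\in S_n\cup T_n\cup U_n\cup V_n$ tends to $0$, uniformly in such $b$, as $n\to\infty$; and consequently $\lim_{b\to8^-}h_F(b)=0$. -/

import Mathlib

open Set Filter Topology

noncomputable section

namespace PWLinear

/-- The planar piecewise linear map `F(x,y) = (|x| - y + a, x - |y| + b)`. -/
def F (a b : ℝ) (z : ℝ × ℝ) : ℝ × ℝ :=
  (|z.1| - z.2 + a, z.1 - |z.2| + b)

/-- The invariant graph of `F (-1) b` for `4 < b < 8`: the union of the five segments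
`P₃P₁₁`, `P₃P₅`, `P₈P₆`, `P₁₁P₉` and `P₈P₁₀`, where `P₃ = (-b-2,-1)`, `P₅ = (b,-1)`,
`P₆ = (b+2,-3)`, `P₈ = (0,b-1)`, `P₉ = (b+4,2b-1)`, `P₁₀ = (b,2b-1)`, `P₁₁ = (b-2,2b-1)`.
The other vertices and marked points of the graph lie on these segments. -/
def Graph (b : ℝ) : Set (ℝ × ℝ) :=
  segment ℝ (-b - 2, -1) (b - 2, 2 * b - 1) ∪
  segment ℝ (-b - 2, -1) (b, -1) ∪
  segment ℝ (0, b - 1) (b + 2, -3) ∪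
  segment ℝ (b - 2, 2 * b - 1) (b + 4, 2 * b - 1) ∪
  segment ℝ (0, b - 1) (b, 2 * b - 1)

/-- The topological entropy of the restriction of `F (-1) b` to its invariant graph.
For an invariant set, `Dynamics.coverEntropy T K` is the (Bowen-Dinaburg) topological entropy
of the restriction of `T` to `K`, see `Dynamics.coverEntropy_restrict`. -/
def entropy (b : ℝ) : EReal :=
  Dynamics.coverEntropy (F (-1) b) (Graph b)

/-- The end points `p n`, with `n ≥ -1`. -/
def p (n : ℤ) : ℝ := 4 * (4 * 4 ^ (n + 1) - 1) / (2 * 4 ^ (n + 1) + 1)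

def q (n : ℕ) : ℝ := (8 * 4 ^ (n + 1) + 1) / (4 ^ (n + 1) + 2)

def r (n : ℕ) : ℝ := (16 * 4 ^ (n + 1) - 1) / (2 * 4 ^ (n + 1) + 4)

def s (n : ℕ) : ℝ := 2 * (4 * 4 ^ (n + 2) - 1) / (4 ^ (n + 2) + 11)

def S (n : ℕ) : Set ℝ := Ioo (p ((n : ℤ) - 1)) (s n)

def T (n : ℕ) : Set ℝ := Icc (s n) (r n)

def U (n : ℕ) : Set ℝ := Ioo (r n) (q n)

def V (n : ℕ) : Set ℝ := Icc (q n) (p n)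

section Polynomials

open Polynomial

def polyAlpha (n : ℕ) : ℝ[X] := X ^ (7 + 3 * n) - X ^ (4 + 3 * n) - 1

def polyBeta (n : ℕ) : ℝ[X] := X ^ (7 + 3 * n) - X ^ (4 + 3 * n) - X ^ 3 - 2

def polyDelta (n : ℕ) : ℝ[X] := X ^ (7 + 3 * n) - X ^ (4 + 3 * n) - 2

def polyGamma (n : ℕ) : ℝ[X] := X ^ (10 + 3 * n) - X ^ (7 + 3 * n) - 2 * X ^ 3 - 1

def polyPhi (n : ℕ) : ℝ[X] := X ^ (10 + 3 * n) - X ^ (7 + 3 * n) - X ^ 3 - 1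

/-- `x` is the unique positive root of the polynomial `P`. -/
def IsUniquePosRoot (P : ℝ[X]) (x : ℝ) : Prop :=
  (0 < x ∧ P.IsRoot x) ∧ ∀ y : ℝ, 0 < y → P.IsRoot y → y = x

end Polynomials

end PWLinear

end

/-!
The third iterate of `F (-1) b` fixes a point of the segment `P₃P₁₁` and expands by `4` along the
segment near it. Every orbit that escapes from this point turns around at the fold of `F (-1) b`,
after which it comes back to an interval between the fixed point and the image of the fold, or
falls into an interval that contributes no entropy. The first return times are `3` and
`c i + 3 * n`, where `n` counts the expansions by `4` needed to leave the neighbourhood of the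
fixed point and the finite list `c` depends on where the orbit of the fold then lands; the intervals
`S n`, `T n`, `U n`, `V n` are the sets of `b` for which it lands between given marked points.

The entropy is compared with the logarithm of the root `x` of the renewal equation
`∑ x ^ (-τ i) = 1` for return times `τ i`. Inverse branches of the returns with disjoint images
generate separated orbits, which bounds the entropy from below. From above, the number of points
needed to split the interval into pieces with close orbits up to time `n` satisfies a renewal
inequality. Multiplied by a power of `x`, the renewal equation becomes the polynomial equation of
the theorem.
-/

noncomputable section

namespace PWLinear

open Dynamics Uniformity

/-! ### Renewal roots -/

section Renewal

variable {ι κ : Type*} [Fintype ι] [Fintype κ] {σ : κ → ℕ} {τ : ι → ℕ} {x y : ℝ}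

/-- The sum `∑ x ^ (-τ i)` of the renewal equation with return times `τ`. -/
def renewalSum (τ : ι → ℕ) (x : ℝ) : ℝ :=
  ∑ i, (x ^ τ i)⁻¹

/-- `x > 1` solves the renewal equation `∑ x ^ (-τ i) = 1`; its logarithm is the exponential growth
rate of a process which returns to itself after each of the times `τ i`. -/
def IsRenewalRoot (τ : ι → ℕ) (x : ℝ) : Prop :=
  1 < x ∧ renewalSum τ x = 1

lemma renewalSum_one (τ : ι → ℕ) : renewalSum τ 1 = Fintype.card ι := by
  simp [renewalSum]

lemma renewalSum_antitoneOn (τ : ι → ℕ) : AntitoneOn (renewalSum τ) (Ioi 0) := by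
  intro x hx y _ hxy
  have hx : 0 < x := hx
  unfold renewalSum
  gcongr

lemma renewalSum_strictAntiOn [Nonempty ι] (hτ : ∀ i, 0 < τ i) :
    StrictAntiOn (renewalSum τ) (Ioi 0) := by
  intro x hx y _ hxy
  have hx : 0 < x := hx
  refine Finset.sum_lt_sum_of_nonempty Finset.univ_nonempty fun i _ ↦ ?_
  have := (hτ i).ne'
  gcongr

lemma continuousAt_renewalSum (τ : ι → ℕ) (hx : x ≠ 0) : ContinuousAt (renewalSum τ) x :=
  tendsto_finsetSum _ fun i _ ↦ ((continuous_pow (τ i)).tendsto x).inv₀ (pow_ne_zero _ hx)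

lemma renewalSum_card_le_one (hτ : ∀ i, 0 < τ i) : renewalSum τ (Fintype.card ι) ≤ 1 := by
  rcases Nat.eq_zero_or_pos (Fintype.card ι) with h | h
  · have := Fintype.card_eq_zero_iff.1 h
    simp [renewalSum]
  have hc : (1 : ℝ) ≤ Fintype.card ι := by exact_mod_cast h
  calc renewalSum τ (Fintype.card ι) ≤ ∑ _i : ι, (Fintype.card ι : ℝ)⁻¹ := by
        unfold renewalSum
        gcongr with i
        exact le_self_pow₀ hc (hτ i).ne'
    _ = 1 := by simp [mul_inv_cancel₀ (by positivity : (Fintype.card ι : ℝ) ≠ 0)]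

lemma exists_isRenewalRoot [Nontrivial ι] (hτ : ∀ i, 0 < τ i) : ∃ x, IsRenewalRoot τ x := by
  have hc : (1 : ℝ) < Fintype.card ι := by exact_mod_cast Fintype.one_lt_card
  obtain ⟨x, hx, hx1⟩ := intermediate_value_Icc' hc.le
    (fun y hy ↦ (continuousAt_renewalSum τ (by linarith [hy.1])).continuousWithinAt)
    (show (1 : ℝ) ∈ Icc (renewalSum τ (Fintype.card ι)) (renewalSum τ 1) from
      ⟨renewalSum_card_le_one hτ, by rw [renewalSum_one]; exact hc.le⟩)
  refine ⟨x, lt_of_le_of_ne hx.1 fun h ↦ ?_, hx1⟩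
  rw [← h, renewalSum_one] at hx1
  exact hc.ne' hx1

lemma IsRenewalRoot.nonempty (hx : IsRenewalRoot τ x) : Nonempty ι := by
  by_contra h
  rw [not_nonempty_iff] at h
  simpa [renewalSum] using hx.2

lemma renewalSum_lt_one (hτ : ∀ i, 0 < τ i) (hx : IsRenewalRoot τ x) (hxy : x < y) :
    renewalSum τ y < 1 := by
  have := hx.nonempty
  have hx0 : 0 < x := one_pos.trans hx.1
  exact hx.2 ▸ renewalSum_strictAntiOn hτ hx0 (hx0.trans hxy) hxy

lemma IsRenewalRoot.lt (hx : IsRenewalRoot σ x) (hy : IsRenewalRoot τ y)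
    (h : renewalSum σ y < renewalSum τ y) : x < y := by
  by_contra! hyx
  have := renewalSum_antitoneOn σ (one_pos.trans hy.1) (one_pos.trans hx.1) hyx
  linarith [hx.2, hy.2]

lemma renewalSum_eq_one_iff {m : ℕ} (hm : ∀ i, τ i ≤ m) (hx : x ≠ 0) :
    renewalSum τ x = 1 ↔ x ^ m - ∑ i, x ^ (m - τ i) = 0 := by
  have h : ∑ i, x ^ (m - τ i) = x ^ m * renewalSum τ x := by
    rw [renewalSum, Finset.mul_sum]
    exact Finset.sum_congr rfl fun i _ ↦ pow_sub₀ x hx (hm i)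
  rw [h, sub_eq_zero, eq_comm (a := x ^ m), mul_eq_left₀ (pow_ne_zero m hx)]

/-- The return times `3` and `c i + 3 * n`: the restriction of `F (-1) b` to its invariant graph
returns to an interval next to a fixed point of its third iterate after these times, where the list
`c` depends on the position of `b` within the `n`-th level. -/
def returnTimes {m : ℕ} (c : Fin m → ℕ) (n : ℕ) : Fin (m + 1) → ℕ :=
  Fin.cons 3 fun i ↦ c i + 3 * n

variable {m : ℕ} {c : Fin m → ℕ}

lemma returnTimes_pos (hc : ∀ i, 0 < c i) (n : ℕ) (i : Fin (m + 1)) : 0 < returnTimes c n i := by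
  cases i using Fin.cases with
  | zero => simp [returnTimes]
  | succ i => simp [returnTimes, hc i]

lemma renewalSum_returnTimes (c : Fin m → ℕ) (n : ℕ) (x : ℝ) :
    renewalSum (returnTimes c n) x = (x ^ 3)⁻¹ + ∑ i, (x ^ (c i + 3 * n))⁻¹ := by
  simp [renewalSum, returnTimes, Fin.sum_univ_succ]

lemma exists_isRenewalRoot_returnTimes [NeZero m] (hc : ∀ i, 0 < c i) (n : ℕ) :
    ∃ x, IsRenewalRoot (returnTimes c n) x :=
  have : Nontrivial (Fin (m + 1)) := Fin.nontrivial_iff_two_le.2 (Nat.succ_le_succ NeZero.one_le)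
  exists_isRenewalRoot (returnTimes_pos hc n)

variable {f : ℕ → ℝ}

lemma strictAnti_of_isRenewalRoot_returnTimes [NeZero m]
    (hf : ∀ n, IsRenewalRoot (returnTimes c n) (f n)) : StrictAnti f := by
  refine strictAnti_nat_of_succ_lt fun n ↦ (hf (n + 1)).lt (hf n) ?_
  have h0 : 0 < f n := one_pos.trans (hf n).1
  simp only [renewalSum_returnTimes]
  gcongr 1
  refine Finset.sum_lt_sum_of_nonempty Finset.univ_nonempty fun i _ ↦ ?_
  gcongr
  · exact (hf n).1
  · exact n.lt_succ_self

lemma tendsto_one_of_isRenewalRoot_returnTimes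
    (hf : ∀ n, IsRenewalRoot (returnTimes c n) (f n)) : Tendsto f atTop (𝓝 1) := by
  refine tendsto_order.2 ⟨fun y hy ↦ .of_forall fun n ↦ hy.trans (hf n).1, fun y hy ↦ ?_⟩
  have hlim : Tendsto (fun n ↦ renewalSum (returnTimes c n) y) atTop
      (𝓝 ((y ^ 3)⁻¹ + ∑ _i : Fin m, 0)) := by
    simp only [renewalSum_returnTimes]
    refine tendsto_const_nhds.add (tendsto_finsetSum _ fun i _ ↦ ?_)
    refine ((tendsto_pow_atTop_atTop_of_one_lt hy).comp ?_).inv_tendsto_atTop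
    exact tendsto_atTop_mono (fun n ↦ (by lia : n ≤ c i + 3 * n)) tendsto_id
  rw [Finset.sum_const_zero, add_zero] at hlim
  filter_upwards [hlim.eventually_lt_const (inv_lt_one_of_one_lt₀ (one_lt_pow₀ hy three_ne_zero))]
    with n hn
  refine lt_of_not_ge fun h ↦ hn.not_ge ?_
  rw [← (hf n).2]
  exact renewalSum_antitoneOn _ (one_pos.trans hy) (one_pos.trans (hf n).1) h

end Renewal

section InverseBranches

open UniformSpace

variable {X ι : Type*} {T : X → X} {K : Set X}

lemma isDynNetIn_image {g : X → X} {W : SetRel X X} {s : Set X} {k n : ℕ}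
    (hg : MapsTo g K K) (hT : ∀ x ∈ K, T^[k] (g x) = x) (hs : IsDynNetIn T K W (n - k) s) :
    IsDynNetIn T K W n (g '' s) := by
  have hball : ∀ x ∈ s, ∀ z ∈ ball (g x) (dynEntourage T W n),
      T^[k] z ∈ ball x (dynEntourage T W (n - k)) := by
    intro x hx z hz
    rw [mem_ball_dynEntourage] at hz ⊢
    intro j hj
    simpa only [Function.iterate_add_apply, hT x (hs.1 hx)] using hz (j + k) (by lia)
  refine ⟨(image_mono hs.1).trans hg.image_subset, ?_⟩
  rintro _ ⟨x, hx, rfl⟩ _ ⟨y, hy, rfl⟩ hxy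
  have hdisj := hs.2 hx hy fun h ↦ hxy (h ▸ rfl)
  exact Set.disjoint_left.2 fun z hzx hzy ↦
    Set.disjoint_left.1 hdisj (hball x hx z hzx) (hball y hy z hzy)

variable {g : ι → X → X} {τ : ι → ℕ}

lemma isDynNetIn_iUnion_image {W : SetRel X X} {n : ℕ} (hn : 0 < n) {s : ι → Set X}
    (hg : ∀ i, MapsTo (g i) K K) (hT : ∀ i, ∀ x ∈ K, T^[τ i] (g i x) = x)
    (hW : Pairwise fun i j ↦ ∀ x ∈ K, ∀ y ∈ K, Disjoint (ball (g i x) W) (ball (g j y) W))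
    (hs : ∀ i, IsDynNetIn T K W (n - τ i) (s i)) :
    IsDynNetIn T K W n (⋃ i, g i '' s i) := by
  have himage (i : ι) := isDynNetIn_image (hg i) (hT i) (hs i)
  refine ⟨iUnion_subset fun i ↦ (himage i).1, ?_⟩
  intro x hx y hy hxy
  obtain ⟨i, hxi⟩ := mem_iUnion.1 hx
  obtain ⟨j, hyj⟩ := mem_iUnion.1 hy
  rcases eq_or_ne i j with rfl | hij
  · exact (himage i).2 hxi hyj hxy
  · have hball (z : X) : ball z (dynEntourage T W n) ⊆ ball z W := fun w hw ↦
      mem_ball_dynEntourage.1 hw 0 hn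
    obtain ⟨u, hu, rfl⟩ := hxi
    obtain ⟨v, hv, rfl⟩ := hyj
    exact (hW hij u ((hs i).1 hu) v ((hs j).1 hv)).mono (hball _) (hball _)

lemma exists_isDynNetIn_pow_le_card [Fintype ι] {W : SetRel X X} {l : ℝ} (hK : K.Nonempty)
    (hτ : ∀ i, 0 < τ i) (hg : ∀ i, MapsTo (g i) K K) (hT : ∀ i, ∀ x ∈ K, T^[τ i] (g i x) = x)
    (hgdisj : Pairwise fun i j ↦ Disjoint (g i '' K) (g j '' K))
    (hW : Pairwise fun i j ↦ ∀ x ∈ K, ∀ y ∈ K, Disjoint (ball (g i x) W) (ball (g j y) W))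
    (hl : IsRenewalRoot τ l) (n : ℕ) :
    ∃ s : Finset X, IsDynNetIn T K W n s ∧ l ^ n ≤ s.card := by
  classical
  induction n using Nat.strong_induction_on with | _ n ih
  rcases n.eq_zero_or_pos with rfl | hn
  · obtain ⟨x, hx⟩ := hK
    exact ⟨{x}, by simpa using isDynNetIn_singleton T W 0 hx, by simp⟩
  have hl0 : 0 < l := one_pos.trans hl.1
  choose s hs hcard using fun i ↦ ih (n - τ i) (Nat.sub_lt hn (hτ i))
  refine ⟨Finset.univ.biUnion fun i ↦ (s i).image (g i),
    by simpa using isDynNetIn_iUnion_image hn hg hT hW hs, ?_⟩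
  rw [Finset.card_biUnion fun i _ j _ hij ↦ ?disj]
  case disj =>
    rw [Function.onFun, ← Finset.disjoint_coe, Finset.coe_image, Finset.coe_image]
    exact (hgdisj hij).mono (image_mono (hs i).1) (image_mono (hs j).1)
  push_cast
  calc l ^ n = ∑ i, l ^ n * (l ^ τ i)⁻¹ := by
        rw [← Finset.mul_sum, ← renewalSum, hl.2, mul_one]
    _ ≤ ∑ i, (((s i).image (g i)).card : ℝ) := by
        gcongr with i
        rw [Finset.card_image_of_injOn fun x hx y hy hxy ↦ by
          rw [← hT i x ((hs i).1 hx), hxy, hT i y ((hs i).1 hy)]]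
        refine le_trans ?_ (hcard i)
        rw [← div_eq_mul_inv, div_le_iff₀ (pow_pos hl0 _), ← pow_add]
        exact pow_le_pow_right₀ hl.1.le (by lia)

lemma exists_entourage_disjoint_ball [Finite ι] [UniformSpace X] [T2Space X] {A : ι → Set X}
    (hA : ∀ i, IsCompact (A i)) (hdisj : Pairwise fun i j ↦ Disjoint (A i) (A j)) :
    ∃ W ∈ 𝓤 X, Pairwise fun i j ↦ ∀ x ∈ A i, ∀ y ∈ A j, Disjoint (ball x W) (ball y W) := by
  have hpair : ∀ q : ι × ι, ∃ W ∈ 𝓤 X, q.1 ≠ q.2 →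
      ∀ x ∈ A q.1, ∀ y ∈ A q.2, Disjoint (ball x W) (ball y W) := by
    rintro ⟨i, j⟩
    by_cases hij : i = j
    · exact ⟨univ, univ_mem, fun h ↦ absurd hij h⟩
    obtain ⟨W, hW, hWdisj⟩ := (hdisj hij).exists_uniform_thickening (hA i) (hA j).isClosed
    refine ⟨W, hW, fun _ x hx y hy ↦ hWdisj.mono ?_ ?_⟩
    · exact subset_biUnion_of_mem (u := fun z ↦ ball z W) hx
    · exact subset_biUnion_of_mem (u := fun z ↦ ball z W) hy
  choose W hW hWdisj using hpair
  refine ⟨⋂ q, W q, Filter.iInter_mem.2 hW, fun i j hij x hx y hy ↦ ?_⟩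
  exact (hWdisj (i, j) hij x hx y hy).mono (ball_mono (iInter_subset W _) x)
    (ball_mono (iInter_subset W _) y)

theorem log_le_coverEntropy_of_inverseBranches [Fintype ι] [UniformSpace X] [T2Space X] {l : ℝ}
    (hKc : IsCompact K) (hK : K.Nonempty) (hτ : ∀ i, 0 < τ i) (hgc : ∀ i, ContinuousOn (g i) K)
    (hg : ∀ i, MapsTo (g i) K K) (hT : ∀ i, ∀ x ∈ K, T^[τ i] (g i x) = x)
    (hgdisj : Pairwise fun i j ↦ Disjoint (g i '' K) (g j '' K)) (hl : IsRenewalRoot τ l) :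
    (Real.log l : EReal) ≤ coverEntropy T K := by
  obtain ⟨W, hW, hWdisj⟩ :=
    exists_entourage_disjoint_ball (fun i ↦ hKc.image_of_continuousOn (hgc i)) hgdisj
  have hl0 : 0 < l := one_pos.trans hl.1
  calc (Real.log l : EReal) = ExpGrowth.expGrowthSup fun n ↦ ENNReal.ofReal l ^ n := by
        rw [ExpGrowth.expGrowthSup_pow, ENNReal.log_ofReal_of_pos hl0]
    _ ≤ netEntropyEntourage T K W := by
        refine ExpGrowth.expGrowthSup_monotone fun n ↦ ?_
        obtain ⟨s, hs, hcard⟩ := exists_isDynNetIn_pow_le_card hK hτ hg hT hgdisj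
          (fun i j hij x hx y hy ↦
            hWdisj hij (g i x) (mem_image_of_mem _ hx) (g j y) (mem_image_of_mem _ hy)) hl n
        calc ENNReal.ofReal l ^ n = ENNReal.ofReal (l ^ n) := (ENNReal.ofReal_pow hl0.le n).symm
          _ ≤ s.card := by simpa using ENNReal.ofReal_le_ofReal hcard
          _ ≤ netMaxcard T K W n := by
            simpa using ENat.toENNReal_mono hs.card_le_netMaxcard
    _ ≤ coverEntropy T K := netEntropyEntourage_le_coverEntropy T K hW

end InverseBranches

section Growth

/-- The relation `a ≲[x] b`: the sequence `a` is bounded by the sequence `b` up to an error term of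
exponential growth rate at most `x`. -/
def GrowthLE (x : ℝ) (a b : ℕ → ℕ) : Prop :=
  ∃ C : ℝ, ∀ n, (a n : ℝ) ≤ b n + C * x ^ n

notation:50 a:51 "≲[" x "]" b:51 => GrowthLE x a b

/-- The sequence `a` delayed by `k` steps. The subtraction is truncated: the values at times before
`k` are `a 0`. -/
def delay (k : ℕ) (a : ℕ → ℕ) (n : ℕ) : ℕ :=
  a (n - k)

variable {x : ℝ} {a b c d : ℕ → ℕ}

lemma growthLE_of_le (h : ∀ n, a n ≤ b n) : a ≲[x] b :=
  ⟨0, fun n ↦ by simpa using h n⟩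

lemma growthLE_of_le_add_const (hx : 1 ≤ x) (k : ℕ) (h : ∀ n, a n ≤ b n + k) : a ≲[x] b := by
  refine ⟨k, fun n ↦ ?_⟩
  calc (a n : ℝ) ≤ b n + k := by exact_mod_cast h n
    _ ≤ b n + k * x ^ n := by
      gcongr
      exact le_mul_of_one_le_right (by positivity) (one_le_pow₀ hx)

@[refl]
lemma GrowthLE.refl (a : ℕ → ℕ) : a ≲[x] a :=
  growthLE_of_le fun _ ↦ le_rfl

lemma GrowthLE.trans (hab : a ≲[x] b) (hbc : b ≲[x] c) : a ≲[x] c := by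
  obtain ⟨C, hC⟩ := hab
  obtain ⟨D, hD⟩ := hbc
  exact ⟨C + D, fun n ↦ by linarith [hC n, hD n, add_mul C D (x ^ n)]⟩

instance : Trans (GrowthLE x) (GrowthLE x) (GrowthLE x) :=
  ⟨GrowthLE.trans⟩

lemma GrowthLE.add (hab : a ≲[x] b) (hcd : c ≲[x] d) : a + c ≲[x] b + d := by
  obtain ⟨C, hC⟩ := hab
  obtain ⟨D, hD⟩ := hcd
  refine ⟨C + D, fun n ↦ ?_⟩
  simp only [Pi.add_apply, Nat.cast_add]
  linarith [hC n, hD n, add_mul C D (x ^ n)]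

lemma delay_delay (j k : ℕ) (a : ℕ → ℕ) : delay k (delay j a) = delay (j + k) a := by
  ext n
  simp only [delay, Nat.sub_sub, add_comm]

lemma delay_add (k : ℕ) (a b : ℕ → ℕ) : delay k (a + b) = delay k a + delay k b :=
  rfl

lemma delay_sum {ι : Type*} (s : Finset ι) (k : ℕ) (f : ι → ℕ → ℕ) :
    delay k (∑ i ∈ s, f i) = ∑ i ∈ s, delay k (f i) := by
  ext n
  simp only [delay, Finset.sum_apply]

lemma GrowthLE.delay (hx : 1 ≤ x) (k : ℕ) (hab : a ≲[x] b) : delay k a ≲[x] delay k b := by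
  obtain ⟨C, hC⟩ := hab
  refine ⟨|C|, fun n ↦ (hC (n - k)).trans ?_⟩
  change _ ≤ (b (n - k) : ℝ) + _
  gcongr
  · exact le_abs_self C
  · exact n.sub_le k

lemma growthLE_zero_of_renewal {ι : Type*} [Fintype ι] {τ : ι → ℕ} (hx : 0 < x) (ha0 : a 0 = 0)
    (hτ : ∀ i, 0 < τ i) (hsum : renewalSum τ x < 1) (h : a ≲[x] ∑ i, delay (τ i) a) :
    a ≲[x] 0 := by
  obtain ⟨C, hC⟩ := h
  set σ := renewalSum τ x
  set D := |C| / (1 - σ)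
  have hD : |C| = D * (1 - σ) := (div_mul_cancel₀ _ (by linarith)).symm
  have : 0 ≤ D := div_nonneg (abs_nonneg C) (by linarith)
  refine ⟨D, fun n ↦ ?_⟩
  rw [Pi.zero_apply, Nat.cast_zero, zero_add]
  induction n using Nat.strong_induction_on with | _ n ih
  have hdelay (i : ι) : (delay (τ i) a n : ℝ) ≤ D * x ^ n * (x ^ τ i)⁻¹ := by
    rcases le_or_gt (τ i) n with hi | hi
    · rw [mul_assoc, ← pow_sub₀ x hx.ne' hi]
      exact ih _ (by have := hτ i; lia)
    · rw [delay, Nat.sub_eq_zero_of_le hi.le, ha0, Nat.cast_zero]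
      positivity
  calc (a n : ℝ) ≤ ∑ i, (delay (τ i) a n : ℝ) + C * x ^ n := by
        simpa [Finset.sum_apply] using hC n
    _ ≤ ∑ i, D * x ^ n * (x ^ τ i)⁻¹ + |C| * x ^ n := by
        gcongr with i
        · exact hdelay i
        · exact le_abs_self C
    _ = D * x ^ n := by
        rw [← Finset.mul_sum, hD]
        change D * x ^ n * σ + _ = _
        ring

end Growth

section Splitting

variable {X : Type*} {T : X → X} {W : SetRel X X} {γ : ℝ → X} {u v u' v' : ℝ} {n : ℕ}

/-- The points of `P` split the arc `γ` over `[u, v]` into pieces whose points have `W`-close orbits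
up to time `n`. -/
def Splits (T : X → X) (W : SetRel X X) (γ : ℝ → X) (u v : ℝ) (n : ℕ) (P : Finset ℝ) : Prop :=
  ∀ s ∈ Icc u v, ∀ t ∈ Icc u v, Disjoint (P : Set ℝ) (uIoo s t) →
    ∀ k < n, (T^[k] (γ s), T^[k] (γ t)) ∈ W

/-- The minimal number of points which split the arc `γ` over `[u, v]` into pieces of `W`-close
orbits up to time `n`. -/
def splitNum (T : X → X) (W : SetRel X X) (γ : ℝ → X) (u v : ℝ) (n : ℕ) : ℕ :=
  sInf (Finset.card '' {P | Splits T W γ u v n P})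

lemma Splits.splitNum_le {P : Finset ℝ} (h : Splits T W γ u v n P) :
    splitNum T W γ u v n ≤ P.card :=
  Nat.sInf_le (mem_image_of_mem _ h)

lemma splitNum_zero : splitNum T W γ u v 0 = 0 :=
  Nat.le_zero.1 (Splits.splitNum_le (P := ∅) fun _ _ _ _ _ _ hk ↦ absurd hk (Nat.not_lt_zero _))

lemma exists_finset_mesh (u v : ℝ) {δ : ℝ} (hδ : 0 < δ) :
    ∃ P : Finset ℝ, ∀ s ∈ Icc u v, ∀ t ∈ Icc u v, Disjoint (P : Set ℝ) (uIoo s t) →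
      dist s t < δ := by
  obtain ⟨A, -, hA, hcover⟩ := (isCompact_Icc (a := u) (b := v)).finite_cover_balls (half_pos hδ)
  refine ⟨hA.toFinset, fun s hs t ht hdisj ↦ ?_⟩
  by_contra! hst
  obtain ⟨p, hp, hmid⟩ := mem_iUnion₂.1 (hcover (show (s + t) / 2 ∈ Icc u v from
    ⟨by linarith [hs.1, ht.1], by linarith [hs.2, ht.2]⟩))
  rw [Metric.mem_ball, Real.dist_eq, abs_lt] at hmid
  refine Set.disjoint_left.1 hdisj (hA.mem_toFinset.2 hp) ?_
  rw [Real.dist_eq, le_abs] at hst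
  rcases hst with hst | hst
  · exact mem_uIoo_of_gt (by linarith [hmid.2]) (by linarith [hmid.1])
  · exact mem_uIoo_of_lt (by linarith [hmid.2]) (by linarith [hmid.1])

lemma mem_uIoo_iff_mul_pos {x y z : ℝ} : z ∈ uIoo x y ↔ 0 < (z - x) * (y - z) := by
  rw [mul_pos_iff, sub_pos, sub_pos, sub_neg, sub_neg]
  rcases le_total x y with h | h
  · rw [uIoo_of_le h]
    exact ⟨Or.inl, fun h' ↦ h'.resolve_right fun h' ↦ by linarith [h'.1, h'.2]⟩
  · rw [uIoo_of_ge h]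
    exact ⟨fun h' ↦ .inr h'.symm, fun h' ↦ (h'.resolve_left fun h' ↦ by linarith [h'.1, h'.2]).symm⟩

lemma mem_uIoo_of_affine {a c s t z : ℝ} (h : z ∈ uIoo (a * s + c) (a * t + c)) :
    (z - c) / a ∈ uIoo s t := by
  rw [mem_uIoo_iff_mul_pos] at h ⊢
  have ha : a ≠ 0 := by
    rintro rfl
    nlinarith [sq_nonneg (z - c)]
  have : (z - (a * s + c)) * (a * t + c - z)
      = a ^ 2 * (((z - c) / a - s) * (t - (z - c) / a)) := by
    field_simp
    ring
  exact pos_of_mul_pos_right (this ▸ h) (sq_nonneg a)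

lemma disjoint_uIoo_of_card_filter_eq {P : Finset ℝ} {s t : ℝ}
    (h : (P.filter (· ≤ s)).card = (P.filter (· ≤ t)).card) : Disjoint (P : Set ℝ) (uIoo s t) := by
  wlog hst : s ≤ t generalizing s t
  · exact uIoo_comm t s ▸ this h.symm (le_of_not_ge hst)
  have hsub : P.filter (· ≤ s) ⊆ P.filter (· ≤ t) :=
    Finset.monotone_filter_right P fun z _ hz ↦ hz.trans hst
  have heq := Finset.eq_of_subset_of_card_le hsub h.ge
  refine Set.disjoint_left.2 fun z hz hzst ↦ ?_
  rw [uIoo_of_le hst] at hzst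
  have : z ∈ P.filter (· ≤ s) := heq ▸ Finset.mem_filter.2 ⟨hz, hzst.2.le⟩
  exact hzst.1.not_ge (Finset.mem_filter.1 this).2

variable [UniformSpace X]

lemma exists_splits (hT : Continuous T) (hγ : Continuous γ) (hW : W ∈ 𝓤 X) (u v : ℝ) (n : ℕ) :
    ∃ P, Splits T W γ u v n P := by
  classical
  induction n with
  | zero => exact ⟨∅, fun _ _ _ _ _ _ hk ↦ absurd hk (Nat.not_lt_zero _)⟩
  | succ n ih =>
    obtain ⟨P, hP⟩ := ih
    have huc : UniformContinuousOn (T^[n] ∘ γ) (Icc u v) :=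
      isCompact_Icc.uniformContinuousOn_of_continuous ((hT.iterate n).comp hγ).continuousOn
    obtain ⟨δ, hδ, hclose⟩ :=
      (Metric.uniformity_basis_dist.uniformContinuousOn_iff (basis_sets _)).1 huc W hW
    obtain ⟨Q, hQ⟩ := exists_finset_mesh u v hδ
    refine ⟨P ∪ Q, fun s hs t ht hdisj k hk ↦ ?_⟩
    rw [Finset.coe_union, disjoint_union_left] at hdisj
    rcases Nat.lt_succ_iff_lt_or_eq.1 hk with hk | rfl
    · exact hP s hs t ht hdisj.1 k hk
    · exact hclose s hs t ht (hQ s hs t ht hdisj.2)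

lemma exists_splits_card_eq (hT : Continuous T) (hγ : Continuous γ) (hW : W ∈ 𝓤 X) (u v : ℝ)
    (n : ℕ) : ∃ P, Splits T W γ u v n P ∧ P.card = splitNum T W γ u v n :=
  Nat.sInf_mem (Set.Nonempty.image _ (exists_splits hT hγ hW u v n))

lemma splitNum_le_add (hT : Continuous T) (hγ : Continuous γ) (hW : W ∈ 𝓤 X) (w : ℝ) :
    splitNum T W γ u v n ≤ splitNum T W γ u w n + splitNum T W γ w v n + 1 := by
  classical
  obtain ⟨P, hP, hPcard⟩ := exists_splits_card_eq hT hγ hW u w n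
  obtain ⟨Q, hQ, hQcard⟩ := exists_splits_card_eq hT hγ hW w v n
  have hPQ : Splits T W γ u v n (insert w (P ∪ Q)) := by
    intro s hs t ht hdisj
    simp only [Finset.coe_insert, Finset.coe_union, disjoint_insert_left, disjoint_union_left]
      at hdisj
    obtain ⟨hw, hdisjP, hdisjQ⟩ := hdisj
    rcases le_or_gt (max s t) w with hle | hgt
    · exact hP s ⟨hs.1, (le_max_left s t).trans hle⟩ t ⟨ht.1, (le_max_right s t).trans hle⟩ hdisjP
    · have hge : w ≤ min s t := by
        by_contra! h
        exact hw ⟨h, hgt⟩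
      exact hQ s ⟨hge.trans (min_le_left s t), hs.2⟩ t ⟨hge.trans (min_le_right s t), ht.2⟩ hdisjQ
  calc splitNum T W γ u v n ≤ (insert w (P ∪ Q)).card := hPQ.splitNum_le
    _ ≤ (P ∪ Q).card + 1 := Finset.card_insert_le _ _
    _ ≤ P.card + Q.card + 1 := by gcongr; exact Finset.card_union_le _ _
    _ = splitNum T W γ u w n + splitNum T W γ w v n + 1 := by rw [hPcard, hQcard]

lemma splitNum_le_of_affine (hT : Continuous T) (hγ : Continuous γ) (hW : W ∈ 𝓤 X) {k : ℕ}
    {a c : ℝ} (hTγ : ∀ x ∈ Icc u v, T^[k] (γ x) = γ (a * x + c))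
    (hmaps : MapsTo (fun x ↦ a * x + c) (Icc u v) (Icc u' v')) :
    splitNum T W γ u v n ≤ splitNum T W γ u' v' (n - k) + splitNum T W γ u v k := by
  classical
  obtain ⟨P, hP, hPcard⟩ := exists_splits_card_eq hT hγ hW u' v' (n - k)
  obtain ⟨Q, hQ, hQcard⟩ := exists_splits_card_eq hT hγ hW u v k
  have hPQ : Splits T W γ u v n (P.image (fun z ↦ (z - c) / a) ∪ Q) := by
    intro s hs t ht hdisj j hj
    rw [Finset.coe_union, Finset.coe_image, disjoint_union_left] at hdisj
    rcases lt_or_ge j k with hjk | hjk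
    · exact hQ s hs t ht hdisj.2 j hjk
    · have hdisjP : Disjoint (P : Set ℝ) (uIoo (a * s + c) (a * t + c)) :=
        Set.disjoint_left.2 fun z hz hzst ↦
          Set.disjoint_left.1 hdisj.1 (mem_image_of_mem _ hz) (mem_uIoo_of_affine hzst)
      rw [← Nat.sub_add_cancel hjk, Function.iterate_add_apply, Function.iterate_add_apply,
        hTγ s hs, hTγ t ht]
      exact hP _ (hmaps hs) _ (hmaps ht) hdisjP _ (by lia)
  calc splitNum T W γ u v n ≤ _ := hPQ.splitNum_le
    _ ≤ (P.image fun z ↦ (z - c) / a).card + Q.card :=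
      Finset.card_union_le (P.image fun z ↦ (z - c) / a) Q
    _ ≤ P.card + Q.card := Nat.add_le_add_right Finset.card_image_le _
    _ = splitNum T W γ u' v' (n - k) + splitNum T W γ u v k := by rw [hPcard, hQcard]

lemma splitNum_self (hW : W ∈ 𝓤 X) : splitNum T W γ u u n = 0 := by
  refine Nat.le_zero.1 (Splits.splitNum_le (P := ∅) fun s hs t ht _ k _ ↦ ?_)
  rw [Icc_self] at hs ht
  rw [hs, ht]
  exact refl_mem_uniformity hW

variable {x : ℝ}

lemma splitNum_growthLE_add (hT : Continuous T) (hγ : Continuous γ) (hW : W ∈ 𝓤 X) (hx : 1 ≤ x)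
    (w : ℝ) : splitNum T W γ u v ≲[x] splitNum T W γ u w + splitNum T W γ w v :=
  growthLE_of_le_add_const hx 1 fun _ ↦ splitNum_le_add hT hγ hW w

lemma splitNum_growthLE_delay (hT : Continuous T) (hγ : Continuous γ) (hW : W ∈ 𝓤 X) (hx : 1 ≤ x)
    {k : ℕ} (a c : ℝ) (hTγ : ∀ z ∈ Icc u v, T^[k] (γ z) = γ (a * z + c))
    (hmaps : MapsTo (fun z ↦ a * z + c) (Icc u v) (Icc u' v')) :
    splitNum T W γ u v ≲[x] delay k (splitNum T W γ u' v') :=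
  growthLE_of_le_add_const hx _ fun _ ↦ splitNum_le_of_affine hT hγ hW hTγ hmaps

lemma splitNum_growthLE_zero (hT : Continuous T) (hγ : Continuous γ) (hW : W ∈ 𝓤 X) (hx : 1 ≤ x)
    {k : ℕ} (c : ℝ) (hTγ : ∀ z ∈ Icc u v, T^[k] (γ z) = γ c) :
    splitNum T W γ u v ≲[x] 0 := by
  have h : splitNum T W γ u v ≲[x] delay k (splitNum T W γ c c) :=
    splitNum_growthLE_delay hT hγ hW hx 0 c (by simpa using hTγ) (by simp [MapsTo])
  exact h.trans (growthLE_of_le fun _ ↦ (splitNum_self hW).le)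

lemma coverMincard_image_Icc_le (hT : Continuous T) (hγ : Continuous γ) (hW : W ∈ 𝓤 X) :
    coverMincard T (γ '' Icc u v) W n ≤ (splitNum T W γ u v n + 1 : ℕ) := by
  classical
  obtain ⟨P, hP, hPcard⟩ := exists_splits_card_eq hT hγ hW u v n
  let piece : ℝ → ℕ := fun s ↦ (P.filter (· ≤ s)).card
  let rep : ℕ → ℝ := Function.invFunOn piece (Icc u v)
  have hcover : IsDynCoverOf T (γ '' Icc u v) W n
      ((Finset.range (P.card + 1)).image (γ ∘ rep) : Finset X) := by
    rintro _ ⟨s, hs, rfl⟩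
    have hex : ∃ t ∈ Icc u v, piece t = piece s := ⟨s, hs, rfl⟩
    refine ⟨γ (rep (piece s)), ?_, mem_dynEntourage.2 ?_⟩
    · exact Finset.mem_image_of_mem _
        (Finset.mem_range.2 (Nat.lt_succ_iff.2 (Finset.card_filter_le _ _)))
    · exact hP s hs _ (Function.invFunOn_mem hex)
        (disjoint_uIoo_of_card_filter_eq (Function.invFunOn_eq hex).symm)
  refine hcover.coverMincard_le_card.trans ?_
  rw [← hPcard]
  exact_mod_cast Finset.card_image_le.trans_eq (Finset.card_range _)

lemma coverEntropy_image_Icc_le_log (hT : Continuous T) (hγ : Continuous γ) (hx : 1 ≤ x)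
    (h : ∀ W ∈ 𝓤 X, splitNum T W γ u v ≲[x] 0) :
    coverEntropy T (γ '' Icc u v) ≤ (Real.log x : EReal) := by
  refine iSup₂_le fun W hW ↦ ?_
  obtain ⟨C, hC⟩ := h W hW
  have hx0 : 0 < x := one_pos.trans_le hx
  rw [← ENNReal.log_ofReal_of_pos hx0, ← ExpGrowth.expGrowthSup_pow]
  refine ExpGrowth.expGrowthSup_le_of_eventually_le (b := ENNReal.ofReal (C + 1))
    ENNReal.ofReal_ne_top (.of_forall fun n ↦ ?_)
  have hbound : (splitNum T W γ u v n + 1 : ℕ) ≤ (C + 1) * x ^ n := by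
    have := hC n
    rw [Pi.zero_apply, Nat.cast_zero, zero_add] at this
    push_cast
    linarith [one_le_pow₀ hx (n := n)]
  calc (coverMincard T (γ '' Icc u v) W n : ENNReal) ≤ (splitNum T W γ u v n + 1 : ℕ) := by
        simpa using ENat.toENNReal_mono (coverMincard_image_Icc_le hT hγ hW)
    _ ≤ ENNReal.ofReal ((C + 1) * x ^ n) := by
        rw [← ENNReal.ofReal_natCast]
        exact ENNReal.ofReal_le_ofReal hbound
    _ = ENNReal.ofReal (C + 1) * ENNReal.ofReal x ^ n := by
        rw [ENNReal.ofReal_mul' (by positivity), ENNReal.ofReal_pow hx0.le]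

theorem coverEntropy_image_Icc_le_log_of_renewal {ι : Type*} [Fintype ι] {τ : ι → ℕ} {r : ℝ}
    (hT : Continuous T) (hγ : Continuous γ) (hτ : ∀ i, 0 < τ i) (hr : IsRenewalRoot τ r)
    (h : ∀ W ∈ 𝓤 X, ∀ x > 1, splitNum T W γ u v ≲[x] ∑ i, delay (τ i) (splitNum T W γ u v)) :
    coverEntropy T (γ '' Icc u v) ≤ (Real.log r : EReal) := by
  have hr0 : 0 < r := one_pos.trans hr.1
  rw [← EReal.le_of_forall_lt_iff_le]
  intro z hz
  have hrz : r < Real.exp z := (Real.log_lt_iff_lt_exp hr0).1 (by exact_mod_cast hz)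
  have hz1 : 1 < Real.exp z := hr.1.trans hrz
  rw [← Real.log_exp z]
  exact coverEntropy_image_Icc_le_log hT hγ hz1.le fun W hW ↦ growthLE_zero_of_renewal
    (Real.exp_pos z) splitNum_zero hτ (renewalSum_lt_one hτ hr hrz) (h W hW _ hz1)

end Splitting

section CharacteristicPolynomials

open Polynomial

variable {ι : Type*} [Fintype ι] {τ : ι → ℕ} {x : ℝ} {n : ℕ}

lemma IsRenewalRoot.isUniquePosRoot {P : ℝ[X]} {m : ℕ} (hx : IsRenewalRoot τ x)
    (hτ : ∀ i, 0 < τ i) (hm : ∀ i, τ i ≤ m)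
    (hP : ∀ y, P.eval y = y ^ m - ∑ i, y ^ (m - τ i)) : IsUniquePosRoot P x := by
  have hroot : ∀ y, 0 < y → (P.IsRoot y ↔ renewalSum τ y = 1) := fun y hy ↦ by
    rw [IsRoot.def, hP, renewalSum_eq_one_iff hm hy.ne']
  have := hx.nonempty
  have hx0 : 0 < x := one_pos.trans hx.1
  exact ⟨⟨hx0, (hroot x hx0).2 hx.2⟩, fun y hy hPy ↦
    (renewalSum_strictAntiOn hτ).injOn hy hx0 (((hroot y hy).1 hPy).trans hx.2.symm)⟩

lemma isUniquePosRoot_of_returnTimes {P : ℝ[X]} {m k : ℕ} {c : Fin m → ℕ}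
    (hx : IsRenewalRoot (returnTimes c n) x) (hc : ∀ i, 0 < c i) (hk : 3 ≤ k) (hck : ∀ i, c i ≤ k)
    (hP : ∀ y, P.eval y = y ^ (k + 3 * n) - (y ^ (k - 3 + 3 * n) + ∑ i, y ^ (k - c i))) :
    IsUniquePosRoot P x := by
  refine hx.isUniquePosRoot (m := k + 3 * n) (returnTimes_pos hc n) (fun i ↦ ?_) fun y ↦ ?_
  · cases i using Fin.cases with
    | zero => exact hk.trans (Nat.le_add_right k _)
    | succ i => exact Nat.add_le_add_right (hck i) _
  · simp only [hP, returnTimes, Fin.sum_univ_succ, Fin.cons_zero, Fin.cons_succ,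
      Nat.add_sub_add_right, Nat.sub_add_comm hk]

lemma isUniquePosRoot_polyAlpha (hx : IsRenewalRoot (returnTimes ![7] n) x) :
    IsUniquePosRoot (polyAlpha n) x :=
  isUniquePosRoot_of_returnTimes (k := 7) hx (by decide) (by decide) (by decide) fun y ↦ by
    simp only [polyAlpha, eval_sub, eval_pow, eval_X, eval_one, Fin.sum_univ_one, Matrix.cons_val]
    ring

lemma isUniquePosRoot_polyBeta (hx : IsRenewalRoot (returnTimes ![4, 7, 7] n) x) :
    IsUniquePosRoot (polyBeta n) x :=
  isUniquePosRoot_of_returnTimes (k := 7) hx (by decide) (by decide) (by decide) fun y ↦ by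
    simp only [polyBeta, eval_sub, eval_pow, eval_X, eval_ofNat, Fin.sum_univ_three,
      Matrix.cons_val]
    ring

lemma isUniquePosRoot_polyGamma (hx : IsRenewalRoot (returnTimes ![7, 7, 10] n) x) :
    IsUniquePosRoot (polyGamma n) x :=
  isUniquePosRoot_of_returnTimes (k := 10) hx (by decide) (by decide) (by decide) fun y ↦ by
    simp only [polyGamma, eval_sub, eval_pow, eval_X, eval_mul, eval_ofNat, eval_one,
      Fin.sum_univ_three, Matrix.cons_val]
    ring

lemma isUniquePosRoot_polyDelta (hx : IsRenewalRoot (returnTimes ![7, 7] n) x) :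
    IsUniquePosRoot (polyDelta n) x :=
  isUniquePosRoot_of_returnTimes (k := 7) hx (by decide) (by decide) (by decide) fun y ↦ by
    simp only [polyDelta, eval_sub, eval_pow, eval_X, eval_ofNat, Fin.sum_univ_two, Matrix.cons_val]
    ring

lemma isUniquePosRoot_polyPhi (hx : IsRenewalRoot (returnTimes ![7, 10] n) x) :
    IsUniquePosRoot (polyPhi n) x :=
  isUniquePosRoot_of_returnTimes (k := 10) hx (by decide) (by decide) (by decide) fun y ↦ by
    simp only [polyPhi, eval_sub, eval_pow, eval_X, eval_one, Fin.sum_univ_two, Matrix.cons_val]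
    ring

end CharacteristicPolynomials

section Comparison

variable {x α β γ δ φ : ℝ} {n : ℕ}

lemma renewalSum_alpha_lt_phi (hx : 0 < x) :
    renewalSum (returnTimes ![7] n) x < renewalSum (returnTimes ![7, 10] n) x := by
  simpa [renewalSum_returnTimes, Fin.sum_univ_succ] using pow_pos hx _

lemma renewalSum_phi_lt_delta (hx : 1 < x) :
    renewalSum (returnTimes ![7, 10] n) x < renewalSum (returnTimes ![7, 7] n) x := by
  have : (x ^ (10 + 3 * n))⁻¹ < (x ^ (7 + 3 * n))⁻¹ := by gcongr; lia
  simpa [renewalSum_returnTimes, Fin.sum_univ_succ] using this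

lemma renewalSum_delta_lt_gamma (hx : 0 < x) :
    renewalSum (returnTimes ![7, 7] n) x < renewalSum (returnTimes ![7, 7, 10] n) x := by
  simpa [renewalSum_returnTimes, Fin.sum_univ_succ] using pow_pos hx _

lemma renewalSum_gamma_lt_beta (hx : 1 < x) :
    renewalSum (returnTimes ![7, 7, 10] n) x < renewalSum (returnTimes ![4, 7, 7] n) x := by
  have : (x ^ (10 + 3 * n))⁻¹ < (x ^ (4 + 3 * n))⁻¹ := by gcongr; lia
  simp only [renewalSum_returnTimes, Fin.sum_univ_three, Matrix.cons_val]
  linarith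

lemma renewalRoots_lt (hα : IsRenewalRoot (returnTimes ![7] n) α)
    (hφ : IsRenewalRoot (returnTimes ![7, 10] n) φ)
    (hδ : IsRenewalRoot (returnTimes ![7, 7] n) δ)
    (hγ : IsRenewalRoot (returnTimes ![7, 7, 10] n) γ)
    (hβ : IsRenewalRoot (returnTimes ![4, 7, 7] n) β) :
    1 < α ∧ α < φ ∧ φ < δ ∧ δ < γ ∧ γ < β :=
  ⟨hα.1, hα.lt hφ (renewalSum_alpha_lt_phi (one_pos.trans hφ.1)),
    hφ.lt hδ (renewalSum_phi_lt_delta hδ.1),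
    hδ.lt hγ (renewalSum_delta_lt_gamma (one_pos.trans hγ.1)),
    hγ.lt hβ (renewalSum_gamma_lt_beta hβ.1)⟩

end Comparison

/-! ### The invariant graph -/

section Geometry

variable {b w x : ℝ}

/-- The line through `P₃` and `P₁₁`, parametrised so that the fixed point of the third iterate of
`F (-1) b` on the segment `P₃P₁₁` has parameter `0`. -/
def spine (b w : ℝ) : ℝ × ℝ := (w - (b + 4) / 3, w + (2 * b - 1) / 3)

/-- The line through `P₃` and `P₅`. -/
def lineB (x : ℝ) : ℝ × ℝ := (x, -1)

/-- The line through `P₈` and `P₆`. -/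
def lineC (b x : ℝ) : ℝ × ℝ := (x, b - 1 - x)

/-- The line through `P₁₁` and `P₉`. -/
def lineD (b x : ℝ) : ℝ × ℝ := (x, 2 * b - 1)

/-- The line through `P₈` and `P₁₀`. -/
def lineE (b x : ℝ) : ℝ × ℝ := (x, x + b - 1)

lemma uniformContinuous_F (a b : ℝ) : UniformContinuous (F a b) :=
  ((Real.uniformContinuous_abs.comp uniformContinuous_fst).sub uniformContinuous_snd
    |>.add uniformContinuous_const).prodMk
  ((uniformContinuous_fst.sub (Real.uniformContinuous_abs.comp uniformContinuous_snd))
    |>.add uniformContinuous_const)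

lemma continuous_spine (b : ℝ) : Continuous (spine b) := by unfold spine; fun_prop

lemma spine_injective (b : ℝ) : Function.Injective (spine b) := fun w w' h ↦ by
  simpa [spine] using congrArg Prod.fst h

lemma F_spine_of_ge (hb : 4 < b) (hw : (b + 4) / 3 ≤ w) :
    F (-1) b (spine b w) = spine b (-(2 * b + 2) / 3) := by
  simp only [F, spine]
  rw [abs_of_nonneg (by linarith), abs_of_nonneg (by linarith)]
  ext <;> ring

lemma F_spine_of_mem (hw : w ∈ Icc ((1 - 2 * b) / 3) ((b + 4) / 3)) :
    F (-1) b (spine b w) = lineB (-2 * w - (b - 2) / 3) := by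
  simp only [F, spine, lineB]
  rw [abs_of_nonpos (by linarith [hw.2]), abs_of_nonneg (by linarith [hw.1])]
  ext <;> ring

lemma F_spine_of_le (hb : 4 < b) (hw : w ≤ (1 - 2 * b) / 3) :
    F (-1) b (spine b w) = lineC b (-2 * w - (b - 2) / 3) := by
  simp only [F, spine, lineC]
  rw [abs_of_nonpos (by linarith), abs_of_nonpos (by linarith)]
  ext <;> ring

lemma F_lineB_of_nonpos (hx : x ≤ 0) : F (-1) b (lineB x) = lineC b (-x) := by
  simp only [F, lineB, lineC, abs_of_nonpos hx, abs_neg, abs_one]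
  ext <;> ring

lemma F_lineB_of_nonneg (hx : 0 ≤ x) : F (-1) b (lineB x) = lineE b x := by
  simp only [F, lineB, lineE, abs_of_nonneg hx, abs_neg, abs_one]
  ext <;> ring

lemma F_lineC_of_mem (hx : x ∈ Icc 0 (b - 1)) :
    F (-1) b (lineC b x) = spine b (2 * x - (2 * b - 4) / 3) := by
  simp only [F, lineC, spine]
  rw [abs_of_nonneg hx.1, abs_of_nonneg (by linarith [hx.2])]
  ext <;> ring

lemma F_lineC_of_ge (hb : 4 < b) (hx : b - 1 ≤ x) :
    F (-1) b (lineC b x) = lineD b (2 * x - b) := by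
  simp only [F, lineC, lineD]
  rw [abs_of_nonneg (by linarith : 0 ≤ x), abs_of_nonpos (by linarith)]
  ext <;> ring

lemma F_lineD (hb : 4 < b) (hx : 0 ≤ x) :
    F (-1) b (lineD b x) = spine b (x - (5 * b - 4) / 3) := by
  simp only [F, lineD, spine]
  rw [abs_of_nonneg hx, abs_of_nonneg (by linarith)]
  ext <;> ring

lemma F_lineE (hb : 4 < b) (hx : 0 ≤ x) :
    F (-1) b (lineE b x) = spine b ((4 - 2 * b) / 3) := by
  simp only [F, lineE, spine]
  rw [abs_of_nonneg hx, abs_of_nonneg (by linarith)]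
  ext <;> ring

lemma segment_eq_image_Icc {E : Type*} [AddCommGroup E] [Module ℝ E] {f : ℝ → E} {u v : ℝ} (d c : E)
    (huv : u ≤ v) (hf : ∀ x, f x = x • d + c) : segment ℝ (f u) (f v) = f '' Icc u v := by
  have hline : f = AffineMap.lineMap c (d + c) := by
    ext x
    rw [hf, AffineMap.lineMap_apply, vsub_eq_sub, vadd_eq_add, add_sub_cancel_right]
  rw [← segment_eq_Icc huv, hline, image_segment]

lemma graph_eq (hb : 4 < b) : Graph b =
    spine b '' Icc (-(2 * b + 2) / 3) ((4 * b - 2) / 3) ∪ lineB '' Icc (-b - 2) b ∪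
      lineC b '' Icc 0 (b + 2) ∪ lineD b '' Icc (b - 2) (b + 4) ∪ lineE b '' Icc 0 b := by
  have affine (p q r s x : ℝ) : x • (p, q) + (r, s) = (x * p + r, x * q + s) := rfl
  rw [← segment_eq_image_Icc (1, 1) (-(b + 4) / 3, (2 * b - 1) / 3) (by linarith)
      fun w ↦ by rw [affine, spine]; ring_nf,
    ← segment_eq_image_Icc (1, 0) (0, -1) (by linarith) fun x ↦ by rw [affine, lineB]; ring_nf,
    ← segment_eq_image_Icc (1, -1) (0, b - 1) (by linarith)
      fun x ↦ by rw [affine, lineC]; ring_nf,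
    ← segment_eq_image_Icc (1, 0) (0, 2 * b - 1) (by linarith)
      fun x ↦ by rw [affine, lineD]; ring_nf,
    ← segment_eq_image_Icc (1, 1) (0, b - 1) (by linarith)
      fun x ↦ by rw [affine, lineE]; ring_nf]
  simp only [Graph, spine, lineB, lineC, lineD, lineE]
  ring_nf

lemma isCompact_graph (b : ℝ) : IsCompact (Graph b) := by
  have hseg : ∀ y z : ℝ × ℝ, IsCompact (segment ℝ y z) := fun y z ↦ by
    rw [segment_eq_image_lineMap]
    exact isCompact_Icc.image AffineMap.lineMap_continuous
  exact ((((hseg _ _).union (hseg _ _)).union (hseg _ _)).union (hseg _ _)).union (hseg _ _)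

lemma spine_mem_graph (hb : 4 < b) (hw : w ∈ Icc (-(2 * b + 2) / 3) ((4 * b - 2) / 3)) :
    spine b w ∈ Graph b :=
  graph_eq hb ▸ .inl (.inl (.inl (.inl (mem_image_of_mem _ hw))))

lemma lineB_mem_graph (hb : 4 < b) (hx : x ∈ Icc (-b - 2) b) : lineB x ∈ Graph b :=
  graph_eq hb ▸ .inl (.inl (.inl (.inr (mem_image_of_mem _ hx))))

lemma lineC_mem_graph (hb : 4 < b) (hx : x ∈ Icc 0 (b + 2)) : lineC b x ∈ Graph b :=
  graph_eq hb ▸ .inl (.inl (.inr (mem_image_of_mem _ hx)))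

lemma lineD_mem_graph (hb : 4 < b) (hx : x ∈ Icc (b - 2) (b + 4)) : lineD b x ∈ Graph b :=
  graph_eq hb ▸ .inl (.inr (mem_image_of_mem _ hx))

lemma lineE_mem_graph (hb : 4 < b) (hx : x ∈ Icc 0 b) : lineE b x ∈ Graph b :=
  graph_eq hb ▸ .inr (mem_image_of_mem _ hx)

lemma F_spine_mem_graph (hb : 4 < b) (hw : w ∈ Icc (-(2 * b + 2) / 3) ((4 * b - 2) / 3)) :
    F (-1) b (spine b w) ∈ Graph b := by
  rcases le_total ((b + 4) / 3) w with hright | hright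
  · rw [F_spine_of_ge hb hright]
    exact spine_mem_graph hb ⟨le_rfl, by linarith⟩
  rcases le_total w ((1 - 2 * b) / 3) with hleft | hleft
  · rw [F_spine_of_le hb hleft]
    exact lineC_mem_graph hb ⟨by linarith, by linarith [hw.1]⟩
  · rw [F_spine_of_mem ⟨hleft, hright⟩]
    exact lineB_mem_graph hb ⟨by linarith, by linarith⟩

lemma F_lineB_mem_graph (hb : 4 < b) (hx : x ∈ Icc (-b - 2) b) :
    F (-1) b (lineB x) ∈ Graph b := by
  rcases le_total x 0 with h0 | h0
  · rw [F_lineB_of_nonpos h0]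
    exact lineC_mem_graph hb ⟨by linarith, by linarith [hx.1]⟩
  · rw [F_lineB_of_nonneg h0]
    exact lineE_mem_graph hb ⟨h0, hx.2⟩

lemma F_lineC_mem_graph (hb : 4 < b) (hx : x ∈ Icc 0 (b + 2)) :
    F (-1) b (lineC b x) ∈ Graph b := by
  rcases le_total x (b - 1) with h0 | h0
  · rw [F_lineC_of_mem ⟨hx.1, h0⟩]
    exact spine_mem_graph hb ⟨by linarith [hx.1], by linarith⟩
  · rw [F_lineC_of_ge hb h0]
    exact lineD_mem_graph hb ⟨by linarith, by linarith [hx.2]⟩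

lemma image_graph_subset (hb : 4 < b) : F (-1) b '' Graph b ⊆ Graph b := by
  rintro _ ⟨z, hz, rfl⟩
  rw [graph_eq hb] at hz
  rcases hz with (((⟨w, hw, rfl⟩ | ⟨x, hx, rfl⟩) | ⟨x, hx, rfl⟩) | ⟨x, hx, rfl⟩) | ⟨x, hx, rfl⟩
  · exact F_spine_mem_graph hb hw
  · exact F_lineB_mem_graph hb hx
  · exact F_lineC_mem_graph hb hx
  · rw [F_lineD hb (by linarith [hx.1])]
    exact spine_mem_graph hb ⟨by linarith [hx.1], by linarith [hx.2]⟩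
  · rw [F_lineE hb hx.1]
    exact spine_mem_graph hb ⟨by linarith, by linarith⟩

lemma image_spine_subset (hb : 4 < b) :
    spine b '' Icc (-(2 * b + 2) / 3) ((4 * b - 2) / 3) ⊆
      F (-1) b '' (lineC b '' Icc 0 (b + 2) ∪ lineD b '' Icc (b - 2) (b + 4)) := by
  rintro _ ⟨w, hw, rfl⟩
  rcases le_total ((4 - 2 * b) / 3) w with h0 | h0
  · refine ⟨lineC b ((w + (2 * b - 4) / 3) / 2),
      .inl ⟨_, ⟨by linarith, by linarith [hw.2]⟩, rfl⟩, ?_⟩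
    rw [F_lineC_of_mem ⟨by linarith, by linarith [hw.2]⟩]
    congr 1
    ring
  · refine ⟨lineD b (w + (5 * b - 4) / 3), .inr ⟨_, ⟨by linarith [hw.1], by linarith⟩, rfl⟩, ?_⟩
    rw [F_lineD hb (by linarith [hw.1]), add_sub_cancel_right]

lemma image_lineB_subset (hb : 4 < b) : lineB '' Icc (-b - 2) b ⊆
    F (-1) b '' (spine b '' Icc (-(2 * b + 2) / 3) ((4 * b - 2) / 3)) := by
  rintro _ ⟨x, hx, rfl⟩
  refine ⟨_, ⟨-(x + (b - 2) / 3) / 2, ⟨by linarith [hx.2], by linarith [hx.1]⟩, rfl⟩, ?_⟩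
  rw [F_spine_of_mem ⟨by linarith [hx.2], by linarith [hx.1]⟩]
  congr 1
  ring

lemma image_lineC_subset (hb : 4 < b) :
    lineC b '' Icc 0 (b + 2) ⊆ F (-1) b '' (lineB '' Icc (-b - 2) b) := by
  rintro _ ⟨x, hx, rfl⟩
  refine ⟨_, ⟨-x, ⟨by linarith [hx.2], by linarith [hx.1]⟩, rfl⟩, ?_⟩
  rw [F_lineB_of_nonpos (by linarith [hx.1]), neg_neg]

lemma image_lineD_subset (hb : 4 < b) :
    lineD b '' Icc (b - 2) (b + 4) ⊆ F (-1) b '' (lineC b '' Icc 0 (b + 2)) := by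
  rintro _ ⟨x, hx, rfl⟩
  refine ⟨_, ⟨(x + b) / 2, ⟨by linarith [hx.1], by linarith [hx.2]⟩, rfl⟩, ?_⟩
  rw [F_lineC_of_ge hb (by linarith [hx.1])]
  congr 1
  ring

lemma image_lineE_subset (hb : 4 < b) :
    lineE b '' Icc 0 b ⊆ F (-1) b '' (lineB '' Icc (-b - 2) b) := by
  rintro _ ⟨x, hx, rfl⟩
  exact ⟨_, ⟨x, ⟨by linarith [hx.1], hx.2⟩, rfl⟩, F_lineB_of_nonneg hx.1⟩

lemma image_graph (hb : 4 < b) : F (-1) b '' Graph b = Graph b := by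
  refine (image_graph_subset hb).antisymm ?_
  have hA := image_subset_iff.2 fun _ ↦ spine_mem_graph hb
  have hB := image_subset_iff.2 fun _ ↦ lineB_mem_graph hb
  have hC := image_subset_iff.2 fun _ ↦ lineC_mem_graph hb
  have hD := image_subset_iff.2 fun _ ↦ lineD_mem_graph hb
  nth_rw 1 [graph_eq hb]
  refine union_subset (union_subset (union_subset (union_subset ?_ ?_) ?_) ?_) ?_
  · exact (image_spine_subset hb).trans (image_mono (union_subset hC hD))
  · exact (image_lineB_subset hb).trans (image_mono hA)
  · exact (image_lineC_subset hb).trans (image_mono hB)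
  · exact (image_lineD_subset hb).trans (image_mono hC)
  · exact (image_lineE_subset hb).trans (image_mono hB)

lemma graph_subset_iterates_spine (hb : 4 < b) :
    Graph b ⊆ ⋃ k : Fin 4,
      (F (-1) b)^[k] '' (spine b '' Icc (-(2 * b + 2) / 3) ((4 * b - 2) / 3)) := by
  set A := spine b '' Icc (-(2 * b + 2) / 3) ((4 * b - 2) / 3) with hA
  have hB : lineB '' Icc (-b - 2) b ⊆ (F (-1) b)^[1] '' A := image_lineB_subset hb
  have hBimage : F (-1) b '' (lineB '' Icc (-b - 2) b) ⊆ (F (-1) b)^[2] '' A := by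
    rw [Function.iterate_succ', image_comp]
    exact image_mono hB
  have hC : lineC b '' Icc 0 (b + 2) ⊆ (F (-1) b)^[2] '' A := (image_lineC_subset hb).trans hBimage
  have hD : lineD b '' Icc (b - 2) (b + 4) ⊆ (F (-1) b)^[3] '' A := by
    rw [Function.iterate_succ', image_comp]
    exact (image_lineD_subset hb).trans (image_mono hC)
  have hE : lineE b '' Icc 0 b ⊆ (F (-1) b)^[2] '' A := (image_lineE_subset hb).trans hBimage
  rw [graph_eq hb, ← hA]
  refine union_subset (union_subset (union_subset (union_subset ?_ ?_) ?_) ?_) ?_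
  · exact subset_iUnion_of_subset 0 (by simp)
  · exact subset_iUnion_of_subset 1 hB
  · exact subset_iUnion_of_subset 2 hC
  · exact subset_iUnion_of_subset 3 hD
  · exact subset_iUnion_of_subset 2 hE

end Geometry

section Iterates

variable {b w : ℝ}

lemma iterate_spine_of_mem_flat (hb : 4 < b) (hw : w ∈ Icc ((1 - 2 * b) / 3) ((2 - b) / 6)) :
    (F (-1) b)^[3] (spine b w) = spine b ((4 - 2 * b) / 3) := by
  simp only [Function.iterate_succ_apply, Function.iterate_zero_apply]
  rw [F_spine_of_mem ⟨hw.1, by linarith [hw.2]⟩, F_lineB_of_nonneg (by linarith [hw.2]),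
    F_lineE hb (by linarith [hw.2])]

lemma iterate_spine_of_mem (hb : 4 < b) (hw : w ∈ Icc ((2 - b) / 6) ((2 * b - 1) / 6)) :
    (F (-1) b)^[3] (spine b w) = spine b (4 * w) := by
  obtain ⟨hw, hw'⟩ := hw
  simp only [Function.iterate_succ_apply, Function.iterate_zero_apply]
  rw [F_spine_of_mem ⟨by linarith, by linarith⟩, F_lineB_of_nonpos (by linarith),
    F_lineC_of_mem ⟨by linarith, by linarith⟩]
  congr 1
  ring

lemma iterate_spine_of_mem_fold (hb : 4 < b) (hw : w ∈ Icc ((2 * b - 1) / 6) ((b + 4) / 3)) :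
    (F (-1) b)^[4] (spine b w) = spine b (4 * w - 2 * b) := by
  obtain ⟨hw, hw'⟩ := hw
  simp only [Function.iterate_succ_apply, Function.iterate_zero_apply]
  rw [F_spine_of_mem ⟨by linarith, by linarith⟩, F_lineB_of_nonpos (by linarith),
    F_lineC_of_ge hb (by linarith), F_lineD hb (by linarith)]
  congr 1
  ring

lemma iterate_spine_of_le (hb : 4 < b) (hw : w ≤ (1 - 2 * b) / 3) :
    (F (-1) b)^[3] (spine b w) = spine b (-4 * w - (10 * b - 8) / 3) := by
  simp only [Function.iterate_succ_apply, Function.iterate_zero_apply]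
  rw [F_spine_of_le hb hw, F_lineC_of_ge hb (by linarith), F_lineD hb (by linarith)]
  congr 1
  ring

lemma iterate_spine_of_pow_mul_le (hb : 4 < b) (hw : 0 ≤ w) {k : ℕ}
    (hkw : 4 ^ k * w ≤ (4 * b - 2) / 3) : (F (-1) b)^[3 * k] (spine b w) = spine b (4 ^ k * w) := by
  induction k with
  | zero => simp
  | succ k ih =>
    have hw4 : 4 ^ (k + 1) * w = 4 * (4 ^ k * w) := by ring
    rw [hw4] at hkw ⊢
    have : 0 ≤ 4 ^ k * w := by positivity
    rw [mul_add_one, add_comm, Function.iterate_add_apply, ih (by linarith),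
      iterate_spine_of_mem hb ⟨by linarith, by linarith⟩]

end Iterates

section Reduction

lemma coverEntropy_iterate_image_le {X : Type*} [UniformSpace X] {T : X → X}
    (hT : UniformContinuous T) (k : ℕ) (K : Set X) :
    coverEntropy T (T^[k] '' K) ≤ coverEntropy T K :=
  coverEntropy_image_le_of_uniformContinuous (Function.Commute.iterate_self T k)
    (hT.iterate T k) K

variable {b t : ℝ}

lemma image_spine_nonneg_subset (hb : 4 < b) (ht : 0 < t) :
    ∃ m : ℕ, spine b '' Icc 0 ((4 * b - 2) / 3) ⊆ (F (-1) b)^[m] '' (spine b '' Icc 0 t) := by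
  obtain ⟨k, hk⟩ := pow_unbounded_of_one_lt ((4 * b - 2) / 3 / t) (by norm_num : (1 : ℝ) < 4)
  rw [div_lt_iff₀ ht] at hk
  refine ⟨3 * k, ?_⟩
  rintro _ ⟨w, hw, rfl⟩
  have hcancel : 4 ^ k * (w / 4 ^ k) = w := mul_div_cancel₀ w (by positivity)
  have hw0 : 0 ≤ w / 4 ^ k := div_nonneg hw.1 (by positivity)
  refine ⟨_, ⟨w / 4 ^ k, ⟨hw0, ?_⟩, rfl⟩, ?_⟩
  · rw [div_le_iff₀' (by positivity)]
    exact hw.2.trans hk.le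
  · rw [iterate_spine_of_pow_mul_le hb hw0 (hcancel.trans_le hw.2), hcancel]

lemma image_spine_nonpos_subset (hb : b ∈ Ioo 4 8) :
    spine b '' Icc (-(2 * b + 2) / 3) 0 ⊆
      (F (-1) b)^[4] '' (spine b '' Icc 0 ((4 * b - 2) / 3)) := by
  obtain ⟨hb4, hb8⟩ := hb
  rintro _ ⟨w, ⟨hw, hw'⟩, rfl⟩
  refine ⟨_, ⟨(w + 2 * b) / 4, ⟨by linarith, by linarith⟩, rfl⟩, ?_⟩
  rw [iterate_spine_of_mem_fold hb4 ⟨by linarith, by linarith⟩]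
  congr 1
  ring

lemma entropy_le_coverEntropy_image_spine (hb : b ∈ Ioo 4 8) (ht : 0 < t) :
    entropy b ≤ coverEntropy (F (-1) b) (spine b '' Icc 0 t) := by
  have hF := uniformContinuous_F (-1) b
  obtain ⟨m, hm⟩ := image_spine_nonneg_subset hb.1 ht
  have hnonneg : coverEntropy (F (-1) b) (spine b '' Icc 0 ((4 * b - 2) / 3)) ≤
      coverEntropy (F (-1) b) (spine b '' Icc 0 t) :=
    (coverEntropy_monotone _ hm).trans (coverEntropy_iterate_image_le hF m _)
  have hnonpos : coverEntropy (F (-1) b) (spine b '' Icc (-(2 * b + 2) / 3) 0) ≤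
      coverEntropy (F (-1) b) (spine b '' Icc 0 ((4 * b - 2) / 3)) :=
    (coverEntropy_monotone _ (image_spine_nonpos_subset hb)).trans
      (coverEntropy_iterate_image_le hF 4 _)
  calc entropy b ≤ coverEntropy (F (-1) b) (⋃ k : Fin 4,
        (F (-1) b)^[k] '' (spine b '' Icc (-(2 * b + 2) / 3) ((4 * b - 2) / 3))) :=
      coverEntropy_monotone _ (graph_subset_iterates_spine hb.1)
    _ ≤ coverEntropy (F (-1) b) (spine b '' Icc (-(2 * b + 2) / 3) ((4 * b - 2) / 3)) := by
      rw [coverEntropy_iUnion_of_finite]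
      exact iSup_le fun k ↦ coverEntropy_iterate_image_le hF k _
    _ ≤ coverEntropy (F (-1) b) (spine b '' Icc 0 t) := by
      rw [← Icc_union_Icc_eq_Icc (b := 0) (by linarith [hb.1]) (by linarith [hb.1]), image_union,
        coverEntropy_union]
      exact max_le (hnonpos.trans hnonneg) hnonneg

end Reduction

/-! ### The upper bounds -/

section UpperBounds

variable {b u v x : ℝ} {W : SetRel (ℝ × ℝ) (ℝ × ℝ)}

/-- The minimal number of points splitting the part of the spine over `[u, v]` into pieces of
`W`-close orbits up to a given time. -/
abbrev spineNum (b : ℝ) (W : SetRel (ℝ × ℝ) (ℝ × ℝ)) (u v : ℝ) : ℕ → ℕ :=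
  splitNum (F (-1) b) W (spine b) u v

/-- The splitting numbers of the part of the spine between the fixed point of the third iterate and
the image `(16 - 2 * b) / 3` of its turning point `(b + 4) / 3`. -/
abbrev baseNum (b : ℝ) (W : SetRel (ℝ × ℝ) (ℝ × ℝ)) : ℕ → ℕ :=
  spineNum b W 0 ((16 - 2 * b) / 3)

lemma spineNum_growthLE_add (hW : W ∈ 𝓤 (ℝ × ℝ)) (hx : 1 < x) (w : ℝ) :
    spineNum b W u v ≲[x] spineNum b W u w + spineNum b W w v :=
  splitNum_growthLE_add (uniformContinuous_F _ _).continuous (continuous_spine b) hW hx.le w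

lemma spineNum_growthLE_delay (hW : W ∈ 𝓤 (ℝ × ℝ)) (hx : 1 < x) {u' v' : ℝ} {k : ℕ} (a c : ℝ)
    (hiter : ∀ w ∈ Icc u v, (F (-1) b)^[k] (spine b w) = spine b (a * w + c))
    (hmaps : MapsTo (fun w ↦ a * w + c) (Icc u v) (Icc u' v')) :
    spineNum b W u v ≲[x] delay k (spineNum b W u' v') :=
  splitNum_growthLE_delay (uniformContinuous_F _ _).continuous (continuous_spine b) hW hx.le a c
    hiter hmaps

lemma spineNum_growthLE_zero (hW : W ∈ 𝓤 (ℝ × ℝ)) (hx : 1 < x) {k : ℕ} (c : ℝ)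
    (hiter : ∀ w ∈ Icc u v, (F (-1) b)^[k] (spine b w) = spine b c) : spineNum b W u v ≲[x] 0 :=
  splitNum_growthLE_zero (uniformContinuous_F _ _).continuous (continuous_spine b) hW hx.le c hiter

lemma spineNum_growthLE_expand (hb : 4 < b) (hW : W ∈ 𝓤 (ℝ × ℝ)) (hx : 1 < x) {u' v' : ℝ}
    (hu : (2 - b) / 6 ≤ u) (hv : v ≤ (2 * b - 1) / 6) (hu' : u' ≤ 4 * u) (hv' : 4 * v ≤ v') :
    spineNum b W u v ≲[x] delay 3 (spineNum b W u' v') := by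
  refine spineNum_growthLE_delay hW hx 4 0 (fun w hw ↦ ?_) fun w hw ↦ ?_
  · rw [iterate_spine_of_mem hb ⟨hu.trans hw.1, hw.2.trans hv⟩, add_zero]
  · exact ⟨by linarith [hw.1], by linarith [hw.2]⟩

lemma spineNum_growthLE_zero_of_ge (hb : 4 < b) (hW : W ∈ 𝓤 (ℝ × ℝ)) (hx : 1 < x)
    (hu : (b + 4) / 3 ≤ u) : spineNum b W u v ≲[x] 0 :=
  spineNum_growthLE_zero (k := 1) hW hx _ fun _ hw ↦ F_spine_of_ge hb (hu.trans hw.1)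

lemma spineNum_neg_growthLE_zero (hb : 4 < b) (hW : W ∈ 𝓤 (ℝ × ℝ)) (hx : 1 < x) :
    spineNum b W ((1 - 2 * b) / 3) 0 ≲[x] 0 := by
  have hflat : spineNum b W ((1 - 2 * b) / 3) ((2 - b) / 6) ≲[x] 0 :=
    spineNum_growthLE_zero hW hx _ fun _ hw ↦ iterate_spine_of_mem_flat hb hw
  have hexpand : spineNum b W ((2 - b) / 6) 0 ≲[x] delay 3 (spineNum b W ((1 - 2 * b) / 3) 0) :=
    spineNum_growthLE_expand hb hW hx le_rfl (by linarith) (by linarith) (by linarith)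
  refine growthLE_zero_of_renewal (τ := fun _ : Fin 1 ↦ 3) (one_pos.trans hx) splitNum_zero
    (by simp) ?_ ?_
  · simpa [renewalSum] using inv_lt_one_of_one_lt₀ (one_lt_pow₀ hx three_ne_zero)
  · calc spineNum b W ((1 - 2 * b) / 3) 0 ≲[x] _ := spineNum_growthLE_add hW hx ((2 - b) / 6)
      _ ≲[x] 0 + delay 3 (spineNum b W ((1 - 2 * b) / 3) 0) := hflat.add hexpand
      _ ≲[x] _ := growthLE_of_le (by simp)

lemma spineNum_neg_growthLE_delay (hb : 4 < b) (hW : W ∈ 𝓤 (ℝ × ℝ)) (hx : 1 < x) :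
    spineNum b W u 0 ≲[x] delay 3 (spineNum b W 0 (-4 * u - (10 * b - 8) / 3)) := by
  set v := -4 * u - (10 * b - 8) / 3 with hv
  have hzero := spineNum_neg_growthLE_zero hb hW hx
  have htarget : spineNum b W ((1 - 2 * b) / 3) v ≲[x] spineNum b W 0 v :=
    calc _ ≲[x] _ := spineNum_growthLE_add hW hx 0
      _ ≲[x] 0 + spineNum b W 0 v := hzero.add (growthLE_of_le fun _ ↦ le_rfl)
      _ ≲[x] _ := growthLE_of_le (by simp)
  have hreverse : spineNum b W u ((1 - 2 * b) / 3) ≲[x]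
      delay 3 (spineNum b W ((1 - 2 * b) / 3) v) := by
    refine spineNum_growthLE_delay hW hx (-4) (-((10 * b - 8) / 3)) (fun w hw ↦ ?_) fun w hw ↦ ?_
    · rw [iterate_spine_of_le hb hw.2, sub_eq_add_neg]
    · exact ⟨by linarith [hw.2], by linarith [hw.1]⟩
  calc _ ≲[x] _ := spineNum_growthLE_add hW hx ((1 - 2 * b) / 3)
    _ ≲[x] delay 3 (spineNum b W 0 v) + 0 := (hreverse.trans (htarget.delay hx.le 3)).add hzero
    _ ≲[x] _ := growthLE_of_le (by simp)

lemma spineNum_fold_growthLE (hb : 4 < b) (hW : W ∈ 𝓤 (ℝ × ℝ)) (hx : 1 < x) {u' v' : ℝ}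
    (hu : (2 * b - 1) / 6 ≤ u) (hv : v ≤ (b + 4) / 3) (hu' : u' ≤ 4 * u - 2 * b)
    (hv' : 4 * v - 2 * b ≤ v') : spineNum b W u v ≲[x] delay 4 (spineNum b W u' v') := by
  refine spineNum_growthLE_delay hW hx 4 (-(2 * b)) (fun w hw ↦ ?_) fun w hw ↦ ?_
  · rw [iterate_spine_of_mem_fold hb ⟨hu.trans hw.1, hw.2.trans hv⟩, sub_eq_add_neg]
  · exact ⟨by linarith [hw.1], by linarith [hw.2]⟩

lemma spineNum_fold_growthLE_delay_four (hb : 4 < b) (hW : W ∈ 𝓤 (ℝ × ℝ)) (hx : 1 < x)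
    (hu : b / 2 ≤ u) (hv : v ≤ (b + 4) / 3) : spineNum b W u v ≲[x] delay 4 (baseNum b W) :=
  spineNum_fold_growthLE hb hW hx (by linarith) hv (by linarith) (by linarith)

lemma spineNum_fold_growthLE_delay_seven (hb : b ∈ Ioo 4 8) (hW : W ∈ 𝓤 (ℝ × ℝ)) (hx : 1 < x)
    (hu : (2 * b - 1) / 6 ≤ u) (hv : v ≤ b / 2) :
    spineNum b W u v ≲[x] delay 7 (baseNum b W) := by
  have hneg := spineNum_neg_growthLE_delay (u := -(2 * b + 2) / 3) hb.1 hW hx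
  rw [show -4 * (-(2 * b + 2) / 3) - (10 * b - 8) / 3 = (16 - 2 * b) / 3 by ring] at hneg
  exact (spineNum_fold_growthLE hb.1 hW hx hu (by linarith [hb.2]) (by linarith)
    (by linarith)).trans (hneg.delay hx.le 4)

lemma spineNum_fold_growthLE_zero (hb : b ∈ Ioo 4 8) (hW : W ∈ 𝓤 (ℝ × ℝ)) (hx : 1 < x)
    (hu : (7 * b + 4) / 24 ≤ u) (hv : v ≤ b / 2) : spineNum b W u v ≲[x] 0 := by
  obtain ⟨hb4, hb8⟩ := hb
  have hneg := spineNum_neg_growthLE_delay (u := (4 - 5 * b) / 6) hb4 hW hx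
  rw [show -4 * ((4 - 5 * b) / 6) - (10 * b - 8) / 3 = 0 by ring] at hneg
  exact (spineNum_fold_growthLE hb4 hW hx (by linarith) (by linarith) (by linarith)
    (by linarith)).trans ((hneg.delay hx.le 4).trans (growthLE_of_le fun _ ↦ (splitNum_self hW).le))

lemma spineNum_growthLE_of_half_le (hb : 4 < b) (hW : W ∈ 𝓤 (ℝ × ℝ)) (hx : 1 < x)
    (hu : b / 2 ≤ u) : spineNum b W u v ≲[x] delay 4 (baseNum b W) :=
  calc _ ≲[x] _ := spineNum_growthLE_add hW hx ((b + 4) / 3)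
    _ ≲[x] delay 4 (baseNum b W) + 0 := (spineNum_fold_growthLE_delay_four hb hW hx hu le_rfl).add
      (spineNum_growthLE_zero_of_ge hb hW hx le_rfl)

lemma spineNum_growthLE_of_mid_le (hb : b ∈ Ioo 4 8) (hW : W ∈ 𝓤 (ℝ × ℝ)) (hx : 1 < x)
    (hu : (7 * b + 4) / 24 ≤ u) : spineNum b W u v ≲[x] delay 4 (baseNum b W) :=
  calc _ ≲[x] _ := spineNum_growthLE_add hW hx (b / 2)
    _ ≲[x] 0 + delay 4 (baseNum b W) := (spineNum_fold_growthLE_zero hb hW hx hu le_rfl).add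
      (spineNum_growthLE_of_half_le hb.1 hW hx le_rfl)
    _ = _ := zero_add _

lemma spineNum_growthLE_of_le (hb : b ∈ Ioo 4 8) (hW : W ∈ 𝓤 (ℝ × ℝ)) (hx : 1 < x)
    (hu : (2 * b - 1) / 6 ≤ u) :
    spineNum b W u v ≲[x] delay 7 (baseNum b W) + delay 4 (baseNum b W) :=
  calc _ ≲[x] _ := spineNum_growthLE_add hW hx (b / 2)
    _ ≲[x] _ := (spineNum_fold_growthLE_delay_seven hb hW hx hu le_rfl).add
      (spineNum_growthLE_of_half_le hb.1 hW hx le_rfl)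

section FundamentalDomain

variable {y : ℝ}

lemma spineNum_fundamental_growthLE_phi (hb : b ∈ Ioo 4 8) (hW : W ∈ 𝓤 (ℝ × ℝ)) (hx : 1 < x)
    (hy : (b + 4) / 3 ≤ 4 * y) (hy' : y ≤ (2 * b - 1) / 6) :
    spineNum b W (y / 4) y ≲[x] delay 7 (baseNum b W) + delay 10 (baseNum b W) := by
  have hb4 := hb.1
  have hzero : spineNum b W y ((2 * b - 1) / 6) ≲[x] 0 :=
    (spineNum_growthLE_expand (v' := (4 * b - 2) / 3) hb4 hW hx (by linarith) le_rfl le_rfl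
      (by linarith)).trans ((spineNum_growthLE_zero_of_ge hb4 hW hx hy).delay hx.le 3)
  have hexpand : spineNum b W y ((4 * b - 2) / 3) ≲[x]
      delay 7 (baseNum b W) + delay 4 (baseNum b W) :=
    calc _ ≲[x] _ := spineNum_growthLE_add hW hx ((2 * b - 1) / 6)
      _ ≲[x] 0 + _ := hzero.add (spineNum_growthLE_of_le hb hW hx le_rfl)
      _ = _ := zero_add _
  calc _ ≲[x] _ :=
        spineNum_growthLE_expand hb4 hW hx (by linarith) hy' (by linarith) (by linarith)
    _ ≲[x] delay 3 (delay 7 (baseNum b W) + delay 4 (baseNum b W)) := hexpand.delay hx.le 3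
    _ = _ := by rw [delay_add, delay_delay, delay_delay, add_comm]

lemma spineNum_fundamental_growthLE_add (hb : 4 < b) (hW : W ∈ 𝓤 (ℝ × ℝ)) (hx : 1 < x)
    (hy : (2 * b - 1) / 6 ≤ y) : spineNum b W (y / 4) y ≲[x]
      spineNum b W ((2 * b - 1) / 6) y + delay 3 (spineNum b W y ((4 * b - 2) / 3)) :=
  calc _ ≲[x] _ := spineNum_growthLE_add hW hx ((2 * b - 1) / 6)
    _ ≲[x] delay 3 (spineNum b W y ((4 * b - 2) / 3)) + _ :=
      (spineNum_growthLE_expand hb hW hx (by linarith) le_rfl (by linarith) (by linarith)).add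
        (.refl _)
    _ = _ := add_comm _ _

lemma spineNum_fundamental_growthLE_gamma (hb : b ∈ Ioo 4 8) (hW : W ∈ 𝓤 (ℝ × ℝ)) (hx : 1 < x)
    (hy : (2 * b - 1) / 6 ≤ y) (hy' : y ≤ b / 2) : spineNum b W (y / 4) y ≲[x]
      delay 7 (baseNum b W) + delay 7 (baseNum b W) + delay 10 (baseNum b W) :=
  calc _ ≲[x] _ := spineNum_fundamental_growthLE_add hb.1 hW hx hy
    _ ≲[x] delay 7 (baseNum b W) + delay 3 (delay 7 (baseNum b W) + delay 4 (baseNum b W)) :=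
      (spineNum_fold_growthLE_delay_seven hb hW hx le_rfl hy').add
        ((spineNum_growthLE_of_le hb hW hx hy).delay hx.le 3)
    _ = _ := by rw [delay_add, delay_delay, delay_delay]; ac_rfl

lemma spineNum_fundamental_growthLE_delta (hb : b ∈ Ioo 4 8) (hW : W ∈ 𝓤 (ℝ × ℝ)) (hx : 1 < x)
    (hy : (7 * b + 4) / 24 ≤ y) (hy' : y ≤ b / 2) :
    spineNum b W (y / 4) y ≲[x] delay 7 (baseNum b W) + delay 7 (baseNum b W) :=
  calc _ ≲[x] _ := spineNum_fundamental_growthLE_add hb.1 hW hx (by linarith [hb.2])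
    _ ≲[x] delay 7 (baseNum b W) + delay 3 (delay 4 (baseNum b W)) :=
      (spineNum_fold_growthLE_delay_seven hb hW hx le_rfl hy').add
        ((spineNum_growthLE_of_mid_le hb hW hx hy).delay hx.le 3)
    _ = _ := by rw [delay_delay]

lemma spineNum_fundamental_growthLE_beta (hb : b ∈ Ioo 4 8) (hW : W ∈ 𝓤 (ℝ × ℝ)) (hx : 1 < x)
    (hy : b / 2 ≤ y) : spineNum b W (y / 4) y ≲[x]
      delay 4 (baseNum b W) + delay 7 (baseNum b W) + delay 7 (baseNum b W) :=
  calc _ ≲[x] _ := spineNum_fundamental_growthLE_add hb.1 hW hx (by linarith [hb.1])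
    _ ≲[x] delay 7 (baseNum b W) + delay 4 (baseNum b W) + delay 3 (delay 4 (baseNum b W)) :=
      (spineNum_growthLE_of_le hb hW hx le_rfl).add
        ((spineNum_growthLE_of_half_le hb.1 hW hx hy).delay hx.le 3)
    _ = _ := by rw [delay_delay]; ac_rfl

end FundamentalDomain

/-- The parameter on the spine reached after `3 * n` iterates by the image `(16 - 2 * b) / 3` of the
turning point, as long as these iterates stay where the third iterate of the map is expanding. -/
def reach (b : ℝ) (n : ℕ) : ℝ :=
  4 ^ n * ((16 - 2 * b) / 3)

variable {n : ℕ}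

lemma baseNum_growthLE (hb : b ∈ Ioo 4 8) (hW : W ∈ 𝓤 (ℝ × ℝ)) (hx : 1 < x)
    (hn : reach b n ≤ (4 * b - 2) / 3) : baseNum b W ≲[x]
      delay 3 (baseNum b W) + delay (3 * n) (spineNum b W (reach b n / 4) (reach b n)) := by
  obtain ⟨hb4, hb8⟩ := hb
  have hnear : spineNum b W 0 ((16 - 2 * b) / 3 / 4) ≲[x] delay 3 (baseNum b W) :=
    spineNum_growthLE_expand hb4 hW hx (by linarith) (by linarith) (by linarith) (by linarith)
  have hfar : spineNum b W ((16 - 2 * b) / 3 / 4) ((16 - 2 * b) / 3) ≲[x]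
      delay (3 * n) (spineNum b W (reach b n / 4) (reach b n)) := by
    have hle : ∀ w ≤ (16 - 2 * b) / 3, 4 ^ n * w ≤ reach b n := fun w hw ↦ by
      unfold reach
      gcongr
    refine spineNum_growthLE_delay hW hx (4 ^ n) 0 (fun w hw ↦ ?_) fun w hw ↦ ?_
    · rw [add_zero]
      exact iterate_spine_of_pow_mul_le hb4 (by linarith [hw.1]) ((hle w hw.2).trans hn)
    · have hge : reach b n / 4 ≤ 4 ^ n * w := by
        rw [reach, mul_div_assoc]
        gcongr
        exact hw.1
      simpa only [add_zero] using ⟨hge, hle w hw.2⟩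
  exact (spineNum_growthLE_add hW hx _).trans (hnear.add hfar)

theorem entropy_le_log_of_fundamental {m : ℕ} {c : Fin m → ℕ} {ρ : ℝ} (hb : b ∈ Ioo 4 8)
    (hn : reach b n ≤ (4 * b - 2) / 3) (hc : ∀ i, 0 < c i)
    (hρ : IsRenewalRoot (returnTimes c n) ρ)
    (h : ∀ W ∈ 𝓤 (ℝ × ℝ), ∀ x > 1,
      spineNum b W (reach b n / 4) (reach b n) ≲[x] ∑ i, delay (c i) (baseNum b W)) :
    entropy b ≤ (Real.log ρ : EReal) := by
  refine (entropy_le_coverEntropy_image_spine hb (t := (16 - 2 * b) / 3)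
    (by linarith [hb.2])).trans ?_
  refine coverEntropy_image_Icc_le_log_of_renewal (uniformContinuous_F _ _).continuous
    (continuous_spine b) (returnTimes_pos hc n) hρ fun W hW x hx ↦ ?_
  calc _ ≲[x] _ := baseNum_growthLE hb hW hx hn
    _ ≲[x] delay 3 (baseNum b W) + delay (3 * n) (∑ i, delay (c i) (baseNum b W)) :=
      (GrowthLE.refl _).add ((h W hW x hx).delay hx.le _)
    _ = _ := by simp only [delay_sum, delay_delay, returnTimes, Fin.sum_univ_succ, Fin.cons_zero,
        Fin.cons_succ]

variable {β γ δ φ : ℝ}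

theorem entropy_le_log_beta (hb : b ∈ Ioo 4 8) (hβ : IsRenewalRoot (returnTimes ![4, 7, 7] n) β)
    (hn : b / 2 ≤ reach b n) (hn' : reach b n ≤ (b + 4) / 3) :
    entropy b ≤ (Real.log β : EReal) :=
  entropy_le_log_of_fundamental hb (by linarith [hb.1]) (by decide) hβ fun W hW x hx ↦ by
    simpa [Fin.sum_univ_three] using spineNum_fundamental_growthLE_beta hb hW hx hn

theorem entropy_le_log_gamma (hb : b ∈ Ioo 4 8)
    (hγ : IsRenewalRoot (returnTimes ![7, 7, 10] n) γ)
    (hn : (2 * b - 1) / 6 ≤ reach b n) (hn' : reach b n ≤ b / 2) :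
    entropy b ≤ (Real.log γ : EReal) :=
  entropy_le_log_of_fundamental hb (by linarith [hb.1]) (by decide) hγ fun W hW x hx ↦ by
    simpa [Fin.sum_univ_three] using spineNum_fundamental_growthLE_gamma hb hW hx hn hn'

theorem entropy_le_log_delta (hb : b ∈ Ioo 4 8) (hδ : IsRenewalRoot (returnTimes ![7, 7] n) δ)
    (hn : (7 * b + 4) / 24 ≤ reach b n) (hn' : reach b n ≤ b / 2) :
    entropy b ≤ (Real.log δ : EReal) :=
  entropy_le_log_of_fundamental hb (by linarith [hb.1]) (by decide) hδ fun W hW x hx ↦ by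
    simpa using spineNum_fundamental_growthLE_delta hb hW hx hn hn'

theorem entropy_le_log_phi (hb : b ∈ Ioo 4 8) (hφ : IsRenewalRoot (returnTimes ![7, 10] n) φ)
    (hn : (b + 4) / 3 ≤ 4 * reach b n) (hn' : reach b n ≤ (2 * b - 1) / 6) :
    entropy b ≤ (Real.log φ : EReal) :=
  entropy_le_log_of_fundamental hb (by linarith [hb.1]) (by decide) hφ fun W hW x hx ↦ by
    simpa using spineNum_fundamental_growthLE_phi hb hW hx hn hn'

end UpperBounds

/-! ### The lower bounds -/

section LowerBounds

variable {b w κ : ℝ} {k m n : ℕ}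

/-- The branch of the inverse of the iterate of order `4 + 3 * k` which crosses the fold through the
points of the spine folded to its nonnegative part, in the parameter of the spine. -/
def directBranch (b : ℝ) (k : ℕ) (w : ℝ) : ℝ := (w + 2 * b) / 4 / 4 ^ k

/-- The branch of the inverse of the iterate of order `7 + 3 * m` which crosses the fold through the
points of the spine folded beyond the parameter `(1 - 2 * b) / 3`, from where the third iterate
reverses the orientation, in the parameter of the spine. -/
def reverseBranch (b : ℝ) (m : ℕ) (w : ℝ) : ℝ := (14 * b + 8 - 3 * w) / 48 / 4 ^ m

lemma continuous_directBranch (b : ℝ) (k : ℕ) : Continuous (directBranch b k) := by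
  unfold directBranch
  fun_prop

lemma continuous_reverseBranch (b : ℝ) (m : ℕ) : Continuous (reverseBranch b m) := by
  unfold reverseBranch
  fun_prop

lemma directBranch_mem (hw : w ∈ Icc 0 ((16 - 2 * b) / 3)) :
    directBranch b k w ∈ Icc (b / 2 / 4 ^ k) ((b + 4) / 3 / 4 ^ k) := by
  have hpow : (0 : ℝ) ≤ 4 ^ k := by positivity
  exact ⟨div_le_div_of_nonneg_right (by linarith [hw.1]) hpow,
    div_le_div_of_nonneg_right (by linarith [hw.2]) hpow⟩

lemma reverseBranch_mem (hw : w ∈ Icc 0 ((16 - 2 * b) / 3)) :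
    reverseBranch b m w ∈ Icc ((2 * b - 1) / 6 / 4 ^ m) ((7 * b + 4) / 24 / 4 ^ m) := by
  have hpow : (0 : ℝ) ≤ 4 ^ m := by positivity
  exact ⟨div_le_div_of_nonneg_right (by linarith [hw.2]) hpow,
    div_le_div_of_nonneg_right (by linarith [hw.1]) hpow⟩

lemma iterate_spine_directBranch (hb : 4 < b) (hw : w ∈ Icc 0 ((16 - 2 * b) / 3)) :
    (F (-1) b)^[4 + 3 * k] (spine b (directBranch b k w)) = spine b w := by
  obtain ⟨hw0, hw⟩ := hw
  have hcancel : 4 ^ k * directBranch b k w = (w + 2 * b) / 4 :=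
    mul_div_cancel₀ _ (by positivity)
  have hnonneg : 0 ≤ directBranch b k w := div_nonneg (by linarith) (by positivity)
  rw [Function.iterate_add_apply, iterate_spine_of_pow_mul_le hb hnonneg (by linarith), hcancel,
    iterate_spine_of_mem_fold hb ⟨by linarith, by linarith⟩]
  congr 1
  ring

lemma iterate_spine_reverseBranch (hb : 4 < b) (hw : w ∈ Icc 0 ((16 - 2 * b) / 3)) :
    (F (-1) b)^[7 + 3 * m] (spine b (reverseBranch b m w)) = spine b w := by
  obtain ⟨hw0, hw⟩ := hw
  have hcancel : 4 ^ m * reverseBranch b m w = (14 * b + 8 - 3 * w) / 48 :=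
    mul_div_cancel₀ _ (by positivity)
  have hnonneg : 0 ≤ reverseBranch b m w := div_nonneg (by linarith) (by positivity)
  rw [show 7 + 3 * m = 3 + (4 + 3 * m) by ring, Function.iterate_add_apply,
    Function.iterate_add_apply, iterate_spine_of_pow_mul_le hb hnonneg (by linarith), hcancel,
    iterate_spine_of_mem_fold hb ⟨by linarith, by linarith⟩, iterate_spine_of_le hb (by linarith)]
  congr 1
  ring

theorem log_le_entropy_of_spine_branches {ι : Type*} [Fintype ι] {τ : ι → ℕ} {g : ι → ℝ → ℝ}
    {l : ℝ} (hb : 4 < b) (hκ : κ ∈ Icc 0 ((4 * b - 2) / 3)) (hτ : ∀ i, 0 < τ i)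
    (hgc : ∀ i, Continuous (g i)) (hg : ∀ i, MapsTo (g i) (Icc 0 κ) (Icc 0 κ))
    (hiter : ∀ i, ∀ w ∈ Icc 0 κ, (F (-1) b)^[τ i] (spine b (g i w)) = spine b w)
    (hdisj : Pairwise fun i j ↦ Disjoint (g i '' Icc 0 κ) (g j '' Icc 0 κ))
    (hl : IsRenewalRoot τ l) : (Real.log l : EReal) ≤ entropy b := by
  -- `w` is recovered from `z = spine b w` as `z.1 + (b + 4) / 3`
  let G (i : ι) (z : ℝ × ℝ) : ℝ × ℝ := spine b (g i (z.1 + (b + 4) / 3))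
  have hG (i : ι) (w : ℝ) : G i (spine b w) = spine b (g i w) := by simp [G, spine]
  have himage (i : ι) : G i '' (spine b '' Icc 0 κ) = spine b '' (g i '' Icc 0 κ) := by
    simp only [image_image, hG]
  calc (Real.log l : EReal) ≤ coverEntropy (F (-1) b) (spine b '' Icc 0 κ) := by
        refine log_le_coverEntropy_of_inverseBranches
          (isCompact_Icc.image (continuous_spine b)) ((nonempty_Icc.2 hκ.1).image _) hτ (g := G)
          (fun i ↦ ?_) (fun i ↦ ?_) (fun i ↦ ?_) (fun i j hij ↦ ?_) hl
        · have := hgc i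
          have := continuous_spine b
          fun_prop
        · rw [mapsTo_iff_image_subset, himage]
          exact image_mono (hg i).image_subset
        · rintro _ ⟨w, hw, rfl⟩
          rw [hG, hiter i w hw]
        · simp only [himage]
          exact (disjoint_image_iff (spine_injective b)).2 (hdisj hij)
    _ ≤ entropy b := by
        refine coverEntropy_monotone _ (image_subset_iff.2 fun w hw ↦ spine_mem_graph hb ⟨?_, ?_⟩)
        · linarith [hw.1]
        · exact hw.2.trans hκ.2

lemma pairwise_disjoint_image_branches (hκ : κ ≤ (16 - 2 * b) / 3)
    (hdirect : κ / 4 < b / 2 / 4 ^ k) (hreverse : κ / 4 < (2 * b - 1) / 6 / 4 ^ m)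
    (hdisj : Disjoint (Icc (b / 2 / 4 ^ k) ((b + 4) / 3 / 4 ^ k))
      (Icc ((2 * b - 1) / 6 / 4 ^ m) ((7 * b + 4) / 24 / 4 ^ m))) :
    Pairwise fun i j ↦ Disjoint (![(· / 4), directBranch b k, reverseBranch b m] i '' Icc 0 κ)
      (![(· / 4), directBranch b k, reverseBranch b m] j '' Icc 0 κ) := by
  have hsub : Icc 0 κ ⊆ Icc 0 ((16 - 2 * b) / 3) := Icc_subset_Icc_right hκ
  have hshrink : (· / 4) '' Icc 0 κ ⊆ Iic (κ / 4) :=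
    image_subset_iff.2 fun w hw ↦ div_le_div_of_nonneg_right hw.2 zero_le_four
  have hdirect_sub : directBranch b k '' Icc 0 κ ⊆ Icc (b / 2 / 4 ^ k) ((b + 4) / 3 / 4 ^ k) :=
    image_subset_iff.2 fun w hw ↦ directBranch_mem (hsub hw)
  have hreverse_sub : reverseBranch b m '' Icc 0 κ ⊆
      Icc ((2 * b - 1) / 6 / 4 ^ m) ((7 * b + 4) / 24 / 4 ^ m) :=
    image_subset_iff.2 fun w hw ↦ reverseBranch_mem (hsub hw)
  have h01 := (Iic_disjoint_Ici.2 hdirect.not_ge).mono hshrink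
    (hdirect_sub.trans Icc_subset_Ici_self)
  have h02 := (Iic_disjoint_Ici.2 hreverse.not_ge).mono hshrink
    (hreverse_sub.trans Icc_subset_Ici_self)
  have h12 := hdisj.mono hdirect_sub hreverse_sub
  intro i j hij
  fin_cases i <;> fin_cases j
  exacts [(hij rfl).elim, h01, h02, h01.symm, (hij rfl).elim, h12, h02.symm, h12.symm,
    (hij rfl).elim]

theorem log_le_entropy_of_disjoint_branches {l : ℝ} (hb : 4 < b)
    (hκ : κ ≤ (16 - 2 * b) / 3) (hdirect : (b + 4) / 3 / 4 ^ k ≤ κ)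
    (hreverse : (7 * b + 4) / 24 / 4 ^ m ≤ κ) (hdirect' : κ / 4 < b / 2 / 4 ^ k)
    (hreverse' : κ / 4 < (2 * b - 1) / 6 / 4 ^ m)
    (hdisj : Disjoint (Icc (b / 2 / 4 ^ k) ((b + 4) / 3 / 4 ^ k))
      (Icc ((2 * b - 1) / 6 / 4 ^ m) ((7 * b + 4) / 24 / 4 ^ m)))
    (hl : IsRenewalRoot ![3, 4 + 3 * k, 7 + 3 * m] l) : (Real.log l : EReal) ≤ entropy b := by
  have hκ0 : 0 ≤ κ := le_trans (by positivity) hdirect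
  have hsub : Icc 0 κ ⊆ Icc 0 ((16 - 2 * b) / 3) := Icc_subset_Icc_right hκ
  refine log_le_entropy_of_spine_branches (g := ![(· / 4), directBranch b k, reverseBranch b m])
    hb ⟨hκ0, by linarith⟩ ?_ ?_ ?_ ?_
    (pairwise_disjoint_image_branches hκ hdirect' hreverse' hdisj) hl <;>
    rw [Fin.forall_fin_succ, Fin.forall_fin_two]
  · exact ⟨three_pos, Nat.add_pos_left four_pos _, Nat.add_pos_left (by decide) _⟩
  · exact ⟨continuous_id.div_const _, continuous_directBranch b k, continuous_reverseBranch b m⟩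
  · refine ⟨fun w hw ↦ ⟨div_nonneg hw.1 zero_le_four, (div_le_self hw.1 ?_).trans hw.2⟩,
      fun w hw ↦ ?_, fun w hw ↦ ?_⟩
    · norm_num
    · have hmem := directBranch_mem (k := k) (hsub hw)
      exact ⟨le_trans (by positivity) hmem.1, hmem.2.trans hdirect⟩
    · have hmem := reverseBranch_mem (m := m) (hsub hw)
      exact ⟨le_trans (div_nonneg (by linarith) (by positivity)) hmem.1, hmem.2.trans hreverse⟩
  · refine ⟨fun w hw ↦ ?_, fun w hw ↦ iterate_spine_directBranch hb (hsub hw),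
      fun w hw ↦ iterate_spine_reverseBranch hb (hsub hw)⟩
    have hmem : w / 4 ∈ Icc ((2 - b) / 6) ((2 * b - 1) / 6) :=
      ⟨by linarith [hw.1], by linarith [hw.2]⟩
    exact (iterate_spine_of_mem hb hmem).trans
      (congrArg (spine b) (mul_div_cancel₀ w four_ne_zero))

lemma returnTimes_pair (c d n : ℕ) : returnTimes ![c, d] n = ![3, c + 3 * n, d + 3 * n] := by
  ext i
  fin_cases i <;> rfl

lemma div_four_pow_succ (x : ℝ) (n : ℕ) : x / 4 ^ (n + 1) = x / 4 / 4 ^ n := by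
  rw [pow_succ', div_div]

theorem log_le_entropy_delta {δ : ℝ} (hb : 4 < b) (hn : (7 * b + 4) / 24 ≤ reach b n)
    (hδ : IsRenewalRoot (returnTimes ![7, 7] n) δ) : (Real.log δ : EReal) ≤ entropy b := by
  have hpow : (0 : ℝ) < 4 ^ n := by positivity
  refine log_le_entropy_of_disjoint_branches (κ := (7 * b + 4) / 24 / 4 ^ n) (k := n + 1) (m := n)
    hb ?_ ?_ le_rfl ?_ ?_ ?_ ?_
  · rwa [div_le_iff₀' hpow]
  · rw [div_four_pow_succ]
    gcongr ?_ / _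
    linarith
  · rw [div_four_pow_succ, div_right_comm]
    gcongr ?_ / _
    linarith
  · rw [div_right_comm]
    gcongr ?_ / _
    linarith
  · refine (Iic_disjoint_Ici.2 (not_le.2 ?_)).mono Icc_subset_Iic_self Icc_subset_Ici_self
    rw [div_four_pow_succ]
    gcongr ?_ / _
    linarith
  · have htimes : 7 + 3 * n = 4 + 3 * (n + 1) := by ring
    rw [returnTimes_pair] at hδ
    nth_rw 1 [htimes] at hδ
    exact hδ

theorem log_le_entropy_phi {φ : ℝ} (hb : 4 < b) (hn : (b + 4) / 3 ≤ 4 * reach b n)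
    (hφ : IsRenewalRoot (returnTimes ![7, 10] n) φ) : (Real.log φ : EReal) ≤ entropy b := by
  have hpow : (0 : ℝ) < 4 ^ n := by positivity
  refine log_le_entropy_of_disjoint_branches (κ := (b + 4) / 3 / 4 ^ (n + 1)) (k := n + 1)
    (m := n + 1) hb ?_ le_rfl ?_ ?_ ?_ ?_ ?_
  · rwa [div_le_iff₀' (by positivity), pow_succ', mul_assoc]
  · gcongr ?_ / _
    linarith
  · rw [div_right_comm]
    gcongr ?_ / _
    linarith
  · rw [div_right_comm]
    gcongr ?_ / _
    linarith
  · refine (Iic_disjoint_Ici.2 (not_le.2 ?_)).symm.mono Icc_subset_Ici_self Icc_subset_Iic_self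
    gcongr ?_ / _
    linarith
  · rwa [returnTimes_pair, show 7 + 3 * n = 4 + 3 * (n + 1) by ring,
      show 10 + 3 * n = 7 + 3 * (n + 1) by ring] at hφ

end LowerBounds

/-! ### The parameter intervals -/

section Intervals

variable {b : ℝ} {n : ℕ}

lemma p_pred (n : ℕ) : p ((n : ℤ) - 1) = 4 * (4 * 4 ^ n - 1) / (2 * 4 ^ n + 1) := by
  rw [p, sub_add_cancel, zpow_natCast]

lemma p_natCast (n : ℕ) : p n = 4 * (16 * 4 ^ n - 1) / (8 * 4 ^ n + 1) := by
  rw [p, ← Nat.cast_succ, zpow_natCast, pow_succ]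
  ring_nf

lemma q_eq (n : ℕ) : q n = (32 * 4 ^ n + 1) / (4 * 4 ^ n + 2) := by
  rw [q, pow_succ]
  ring_nf

lemma r_eq (n : ℕ) : r n = (64 * 4 ^ n - 1) / (8 * 4 ^ n + 4) := by
  rw [r, pow_succ]
  ring_nf

lemma s_eq (n : ℕ) : s n = 2 * (64 * 4 ^ n - 1) / (16 * 4 ^ n + 11) := by
  rw [s, pow_add]
  ring_nf

lemma one_le_four_pow (n : ℕ) : (1 : ℝ) ≤ 4 ^ n := one_le_pow₀ (by norm_num)

lemma p_pred_lt_s (n : ℕ) : p ((n : ℤ) - 1) < s n := by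
  have hn := one_le_four_pow n
  rw [p_pred, s_eq, div_lt_div_iff₀ (by linarith) (by linarith)]
  nlinarith

lemma s_lt_r (n : ℕ) : s n < r n := by
  have hn := one_le_four_pow n
  rw [s_eq, r_eq, div_lt_div_iff₀ (by linarith) (by linarith)]
  nlinarith

lemma r_lt_q (n : ℕ) : r n < q n := by
  have hn := one_le_four_pow n
  rw [r_eq, q_eq, div_lt_div_iff₀ (by linarith) (by linarith)]
  nlinarith

lemma q_lt_p (n : ℕ) : q n < p n := by
  have hn := one_le_four_pow n
  rw [q_eq, p_natCast, div_lt_div_iff₀ (by linarith) (by linarith)]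
  nlinarith

lemma p_pred_lt_iff : p ((n : ℤ) - 1) < b ↔ reach b n < (b + 4) / 3 := by
  have hn := one_le_four_pow n
  rw [p_pred, div_lt_iff₀ (by linarith), reach]
  constructor <;> intro h <;> linarith

lemma le_p_iff : b ≤ p n ↔ (b + 4) / 3 ≤ 4 * reach b n := by
  have hn := one_le_four_pow n
  rw [p_natCast, le_div_iff₀ (by linarith), reach]
  constructor <;> intro h <;> linarith

lemma q_le_iff : q n ≤ b ↔ reach b n ≤ (2 * b - 1) / 6 := by
  have hn := one_le_four_pow n
  rw [q_eq, div_le_iff₀ (by linarith), reach]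
  constructor <;> intro h <;> linarith

lemma reach_le_of_s_le (hb : 4 < b) (h : s n ≤ b) : reach b n ≤ b / 2 := by
  have hn := one_le_four_pow n
  rw [s_eq, div_le_iff₀ (by linarith)] at h
  unfold reach
  linarith

lemma le_reach_of_le_r (hb : 4 < b) (h : b ≤ r n) : (7 * b + 4) / 24 ≤ reach b n := by
  have hn := one_le_four_pow n
  rw [r_eq, le_div_iff₀ (by linarith)] at h
  unfold reach
  linarith

lemma levels_eq_Ioc (n : ℕ) : S n ∪ T n ∪ U n ∪ V n = Ioc (p ((n : ℤ) - 1)) (p n) := by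
  have hsr := s_lt_r n
  have hrq := r_lt_q n
  rw [S, T, U, V, Ioo_union_Icc_eq_Ioc (p_pred_lt_s n) hsr.le,
    Ioc_union_Ioo_eq_Ioo ((p_pred_lt_s n).trans hsr).le hrq,
    Ioo_union_Icc_eq_Ioc (((p_pred_lt_s n).trans hsr).trans hrq) (q_lt_p n).le]

lemma strictMono_p_pred : StrictMono fun n : ℕ ↦ p ((n : ℤ) - 1) :=
  strictMono_nat_of_lt_succ fun n ↦ by
    simpa using (((p_pred_lt_s n).trans (s_lt_r n)).trans (r_lt_q n)).trans (q_lt_p n)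

lemma p_pred_lt_eight (n : ℕ) : p ((n : ℤ) - 1) < 8 := by
  have hn := one_le_four_pow n
  rw [p_pred, div_lt_iff₀ (by linarith)]
  linarith

lemma exists_le_p_pred (hb : b < 8) : ∃ n : ℕ, b ≤ p ((n : ℤ) - 1) := by
  obtain ⟨n, hn⟩ := pow_unbounded_of_one_lt ((b + 4) / (16 - 2 * b)) (by norm_num : (1 : ℝ) < 4)
  rw [div_lt_iff₀ (by linarith)] at hn
  refine ⟨n, not_lt.1 fun h ↦ ?_⟩
  rw [p_pred_lt_iff, reach] at h
  linarith

lemma Ioo_eq_iUnion_levels : Ioo (4 : ℝ) 8 = ⋃ n : ℕ, (S n ∪ T n ∪ U n ∪ V n) := by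
  have hzero : p (((0 : ℕ) : ℤ) - 1) = 4 := by
    rw [p_pred]
    norm_num
  have hlevel (n : ℕ) : S n ∪ T n ∪ U n ∪ V n =
      Ioc (p ((n : ℤ) - 1)) (p (((n + 1 : ℕ) : ℤ) - 1)) := by
    rw [levels_eq_Ioc, Nat.cast_succ, add_sub_cancel_right]
  refine Subset.antisymm (fun b ⟨hb4, hb8⟩ ↦ ?_) (iUnion_subset fun n b hb ↦ ?_)
  · obtain ⟨N, hN⟩ := exists_le_p_pred hb8
    have hb : b ∈ Ioc (p (((0 : ℕ) : ℤ) - 1)) (p ((N : ℤ) - 1)) := ⟨hzero.trans_lt hb4, hN⟩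
    rw [← strictMono_p_pred.monotone.biUnion_Ico_Ioc_map_succ 0 N] at hb
    obtain ⟨n, -, hn⟩ := mem_iUnion₂.1 hb
    exact mem_iUnion.2 ⟨n, (hlevel n).superset hn⟩
  · rw [hlevel] at hb
    exact ⟨(hzero.symm.trans_le (strictMono_p_pred.monotone n.zero_le)).trans_lt hb.1,
      hb.2.trans_lt (p_pred_lt_eight _)⟩

lemma mem_Ioo_of_mem_level (hb : b ∈ S n ∪ T n ∪ U n ∪ V n) : b ∈ Ioo (4 : ℝ) 8 :=
  Ioo_eq_iUnion_levels.superset (mem_iUnion.2 ⟨n, hb⟩)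

lemma le_of_p_pred_lt_of_mem_level {N : ℕ} (hN : p ((N : ℤ) - 1) < b)
    (hb : b ∈ S n ∪ T n ∪ U n ∪ V n) : N ≤ n := by
  rw [levels_eq_Ioc] at hb
  refine Nat.lt_succ_iff.1 (strictMono_p_pred.lt_iff_lt.1 (hN.trans_le ?_))
  simpa using hb.2

end Intervals

/-! ### The entropy on the parameter intervals -/

section Entropy

variable {b : ℝ} {n : ℕ} {α β γ δ φ : ℝ}

lemma coe_log_le_coe_log {x y : ℝ} (hx : 1 < x) (hxy : x ≤ y) :
    (Real.log x : EReal) ≤ (Real.log y : EReal) :=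
  EReal.coe_le_coe_iff.2 (Real.log_le_log (one_pos.trans hx) hxy)

lemma log_phi_le_entropy_of_mem_level (hb : b ∈ S n ∪ T n ∪ U n ∪ V n)
    (hφ : IsRenewalRoot (returnTimes ![7, 10] n) φ) : (Real.log φ : EReal) ≤ entropy b := by
  have hb4 := (mem_Ioo_of_mem_level hb).1
  rw [levels_eq_Ioc] at hb
  exact log_le_entropy_phi hb4 (le_p_iff.1 hb.2) hφ

lemma entropy_eq_log_delta (hb : b ∈ T n) (hδ : IsRenewalRoot (returnTimes ![7, 7] n) δ) :
    entropy b = (Real.log δ : EReal) := by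
  have hb48 : b ∈ Ioo 4 8 := mem_Ioo_of_mem_level (.inl (.inl (.inr hb)))
  have hreach := le_reach_of_le_r hb48.1 hb.2
  exact (entropy_le_log_delta hb48 hδ hreach (reach_le_of_s_le hb48.1 hb.1)).antisymm
    (log_le_entropy_delta hb48.1 hreach hδ)

lemma entropy_eq_log_phi (hb : b ∈ V n) (hφ : IsRenewalRoot (returnTimes ![7, 10] n) φ) :
    entropy b = (Real.log φ : EReal) :=
  (entropy_le_log_phi (mem_Ioo_of_mem_level (.inr hb)) hφ (le_p_iff.1 hb.2)
    (q_le_iff.1 hb.1)).antisymm (log_phi_le_entropy_of_mem_level (.inr hb) hφ)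

lemma entropy_le_log_gamma_of_mem (hb : b ∈ U n)
    (hγ : IsRenewalRoot (returnTimes ![7, 7, 10] n) γ) : entropy b ≤ (Real.log γ : EReal) := by
  have hb48 : b ∈ Ioo 4 8 := mem_Ioo_of_mem_level (.inl (.inr hb))
  exact entropy_le_log_gamma hb48 hγ (not_le.1 (q_le_iff.not.1 hb.2.not_ge)).le
    (reach_le_of_s_le hb48.1 ((s_lt_r n).trans hb.1).le)

lemma entropy_le_log_beta_of_mem (hb : b ∈ S n)
    (hβ : IsRenewalRoot (returnTimes ![4, 7, 7] n) β) : entropy b ≤ (Real.log β : EReal) := by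
  have hb48 : b ∈ Ioo 4 8 := mem_Ioo_of_mem_level (.inl (.inl (.inl hb)))
  rcases le_total (b / 2) (reach b n) with hreach | hreach
  · exact entropy_le_log_beta hb48 hβ hreach (p_pred_lt_iff.1 hb.1).le
  · obtain ⟨δ, hδ⟩ := exists_isRenewalRoot_returnTimes (c := ![7, 7]) (by decide) n
    have hδβ : δ < β := hδ.lt hβ
      ((renewalSum_delta_lt_gamma (one_pos.trans hβ.1)).trans (renewalSum_gamma_lt_beta hβ.1))
    have hreach' := le_reach_of_le_r hb48.1 (hb.2.trans (s_lt_r n)).le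
    exact (entropy_le_log_delta hb48 hδ hreach' hreach).trans (coe_log_le_coe_log hδ.1 hδβ.le)

lemma log_alpha_le_entropy_of_mem_level (hb : b ∈ S n ∪ T n ∪ U n ∪ V n)
    (hα : IsRenewalRoot (returnTimes ![7] n) α) : (Real.log α : EReal) ≤ entropy b := by
  obtain ⟨φ, hφ⟩ := exists_isRenewalRoot_returnTimes (c := ![7, 10]) (by decide) n
  have hαφ : α < φ := hα.lt hφ (renewalSum_alpha_lt_phi (one_pos.trans hφ.1))
  exact (coe_log_le_coe_log hα.1 hαφ.le).trans (log_phi_le_entropy_of_mem_level hb hφ)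

lemma entropy_le_log_beta_of_mem_level (hb : b ∈ S n ∪ T n ∪ U n ∪ V n)
    (hβ : IsRenewalRoot (returnTimes ![4, 7, 7] n) β) : entropy b ≤ (Real.log β : EReal) := by
  obtain ⟨α, hα⟩ := exists_isRenewalRoot_returnTimes (c := ![7]) (by decide) n
  obtain ⟨γ, hγ⟩ := exists_isRenewalRoot_returnTimes (c := ![7, 7, 10]) (by decide) n
  obtain ⟨δ, hδ⟩ := exists_isRenewalRoot_returnTimes (c := ![7, 7]) (by decide) n
  obtain ⟨φ, hφ⟩ := exists_isRenewalRoot_returnTimes (c := ![7, 10]) (by decide) n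
  obtain ⟨-, -, hφδ, hδγ, hγβ⟩ := renewalRoots_lt hα hφ hδ hγ hβ
  rcases hb with ((hS | hT) | hU) | hV
  · exact entropy_le_log_beta_of_mem hS hβ
  · exact (entropy_eq_log_delta hT hδ).trans_le (coe_log_le_coe_log hδ.1 (hδγ.trans hγβ).le)
  · exact (entropy_le_log_gamma_of_mem hU hγ).trans (coe_log_le_coe_log hγ.1 hγβ.le)
  · exact (entropy_eq_log_phi hV hφ).trans_le
      (coe_log_le_coe_log hφ.1 (hφδ.trans (hδγ.trans hγβ)).le)

theorem entropy_pos (hb : b ∈ Ioo (4 : ℝ) 8) : 0 < entropy b := by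
  obtain ⟨n, hn⟩ := mem_iUnion.1 (Ioo_eq_iUnion_levels.subset hb)
  obtain ⟨φ, hφ⟩ := exists_isRenewalRoot_returnTimes (c := ![7, 10]) (by decide) n
  exact (EReal.coe_pos.2 (Real.log_pos hφ.1)).trans_le (log_phi_le_entropy_of_mem_level hn hφ)

theorem exists_forall_entropy_lt {ε : ℝ} (hε : 0 < ε) :
    ∃ N : ℕ, ∀ n ≥ N, ∀ b ∈ S n ∪ T n ∪ U n ∪ V n, entropy b < (ε : EReal) := by
  choose β hβ using exists_isRenewalRoot_returnTimes (c := ![4, 7, 7]) (by decide)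
  have hlog : Tendsto (fun n ↦ Real.log (β n)) atTop (𝓝 0) := by
    simpa using (tendsto_one_of_isRenewalRoot_returnTimes hβ).log one_ne_zero
  obtain ⟨N, hN⟩ := eventually_atTop.1 (hlog.eventually_lt_const hε)
  exact ⟨N, fun n hn b hb ↦ (entropy_le_log_beta_of_mem_level hb (hβ n)).trans_lt
    (EReal.coe_lt_coe_iff.2 (hN n hn))⟩

theorem tendsto_entropy_nhdsLT_eight : Tendsto entropy (𝓝[<] (8 : ℝ)) (𝓝 0) := by
  refine tendsto_order.2 ⟨fun a ha ↦ ?_, fun a ha ↦ ?_⟩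
  · filter_upwards [Ioo_mem_nhdsLT (by norm_num : (4 : ℝ) < 8)] with b hb
    exact ha.trans (entropy_pos hb)
  · obtain ⟨ε, hε, hεa⟩ := EReal.lt_iff_exists_real_btwn.1 ha
    obtain ⟨N, hN⟩ := exists_forall_entropy_lt (EReal.coe_pos.1 hε)
    filter_upwards [Ioo_mem_nhdsLT (p_pred_lt_eight N),
      Ioo_mem_nhdsLT (by norm_num : (4 : ℝ) < 8)] with b hbN hb
    obtain ⟨n, hn⟩ := mem_iUnion.1 (Ioo_eq_iUnion_levels.subset hb)
    exact (hN n (le_of_p_pred_lt_of_mem_level hbN.1 hn) b hn).trans hεa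

end Entropy

end PWLinear

end

open PWLinear in
theorem mainTheorem2 :
    -- the intervals `S n, T n, U n, V n` split `(4, 8)`
    (∀ n : ℕ, p ((n : ℤ) - 1) < s n ∧ s n < r n ∧ r n < q n ∧ q n < p n) ∧
    (Ioo (4 : ℝ) 8 = ⋃ n : ℕ, (S n ∪ T n ∪ U n ∪ V n)) ∧
    -- the graph is compact and invariant
    (∀ b ∈ Ioo (4 : ℝ) 8, IsCompact (Graph b) ∧ F (-1) b '' Graph b = Graph b) ∧
    -- the entropy is positive
    (∀ b ∈ Ioo (4 : ℝ) 8, 0 < entropy b) ∧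
    ∃ α β γ δ φ : ℕ → ℝ,
      (∀ n, IsUniquePosRoot (polyAlpha n) (α n)) ∧
      (∀ n, IsUniquePosRoot (polyBeta n) (β n)) ∧
      (∀ n, IsUniquePosRoot (polyGamma n) (γ n)) ∧
      (∀ n, IsUniquePosRoot (polyDelta n) (δ n)) ∧
      (∀ n, IsUniquePosRoot (polyPhi n) (φ n)) ∧
      (∀ n, ∀ b ∈ S n,
        (Real.log (α n) : EReal) ≤ entropy b ∧ entropy b ≤ (Real.log (β n) : EReal)) ∧
      (∀ n, ∀ b ∈ T n, entropy b = (Real.log (δ n) : EReal)) ∧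
      (∀ n, ∀ b ∈ U n,
        (Real.log (α n) : EReal) ≤ entropy b ∧ entropy b ≤ (Real.log (γ n) : EReal)) ∧
      (∀ n, ∀ b ∈ V n, entropy b = (Real.log (φ n) : EReal)) ∧
      (∀ n, 1 < α n ∧ α n < φ n ∧ φ n < δ n ∧ δ n < γ n ∧ γ n < β n) ∧
      (StrictAnti α ∧ StrictAnti β ∧ StrictAnti γ ∧ StrictAnti δ ∧ StrictAnti φ) ∧
      (Tendsto α atTop (𝓝 1) ∧ Tendsto β atTop (𝓝 1) ∧ Tendsto γ atTop (𝓝 1) ∧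
        Tendsto δ atTop (𝓝 1) ∧ Tendsto φ atTop (𝓝 1)) ∧
      -- the entropy on the `n`-th level tends to `0`, uniformly in `b`
      (∀ ε : ℝ, 0 < ε → ∃ N : ℕ, ∀ n ≥ N, ∀ b ∈ S n ∪ T n ∪ U n ∪ V n,
        entropy b < (ε : EReal)) ∧
      Tendsto entropy (𝓝[<] (8 : ℝ)) (𝓝 0) := by
  choose α hα using exists_isRenewalRoot_returnTimes (c := ![7]) (by decide)
  choose β hβ using exists_isRenewalRoot_returnTimes (c := ![4, 7, 7]) (by decide)
  choose γ hγ using exists_isRenewalRoot_returnTimes (c := ![7, 7, 10]) (by decide)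
  choose δ hδ using exists_isRenewalRoot_returnTimes (c := ![7, 7]) (by decide)
  choose φ hφ using exists_isRenewalRoot_returnTimes (c := ![7, 10]) (by decide)
  refine ⟨fun n ↦ ⟨p_pred_lt_s n, s_lt_r n, r_lt_q n, q_lt_p n⟩, Ioo_eq_iUnion_levels,
    fun b hb ↦ ⟨isCompact_graph b, image_graph hb.1⟩, fun b hb ↦ entropy_pos hb, α, β, γ, δ, φ,
    fun n ↦ isUniquePosRoot_polyAlpha (hα n), fun n ↦ isUniquePosRoot_polyBeta (hβ n),
    fun n ↦ isUniquePosRoot_polyGamma (hγ n), fun n ↦ isUniquePosRoot_polyDelta (hδ n),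
    fun n ↦ isUniquePosRoot_polyPhi (hφ n),
    fun n b hb ↦ ⟨log_alpha_le_entropy_of_mem_level (.inl (.inl (.inl hb))) (hα n),
      entropy_le_log_beta_of_mem hb (hβ n)⟩,
    fun n b hb ↦ entropy_eq_log_delta hb (hδ n),
    fun n b hb ↦ ⟨log_alpha_le_entropy_of_mem_level (.inl (.inr hb)) (hα n),
      entropy_le_log_gamma_of_mem hb (hγ n)⟩,
    fun n b hb ↦ entropy_eq_log_phi hb (hφ n),
    fun n ↦ renewalRoots_lt (hα n) (hφ n) (hδ n) (hγ n) (hβ n),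
    ⟨strictAnti_of_isRenewalRoot_returnTimes hα, strictAnti_of_isRenewalRoot_returnTimes hβ,
      strictAnti_of_isRenewalRoot_returnTimes hγ, strictAnti_of_isRenewalRoot_returnTimes hδ,
      strictAnti_of_isRenewalRoot_returnTimes hφ⟩,
    ⟨tendsto_one_of_isRenewalRoot_returnTimes hα, tendsto_one_of_isRenewalRoot_returnTimes hβ,
      tendsto_one_of_isRenewalRoot_returnTimes hγ, tendsto_one_of_isRenewalRoot_returnTimes hδ,
      tendsto_one_of_isRenewalRoot_returnTimes hφ⟩,
    fun ε hε ↦ exists_forall_entropy_lt hε, tendsto_entropy_nhdsLT_eight⟩
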